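/- Let $k$ be a field of arbitrary characteristic, $N$ a lattice (a free abelian group of finite rank $d$) and $M=\operatorname{Hom}(N,\mathbf Z)$. Let $\Sigma$ be a fan in $N_{\mathbf R}$, i.e. a finite set of strictly convex rational polyhedral cones which contains every face of each of its cones and in which any two cones meet along a common face. For $\sigma\in\Sigma$ let $\check\sigma\subset M_{\mathbf R}$ be the dual cone. Let $\Gamma=(\Gamma_\sigma)_{\sigma\in\Sigma}$ be a family of finitely generated subsemigroups of $M$ containing $0$ such that $\mathbf Z\Gamma_\sigma=M$ and $\mathbf R_{\ge 0}\Gamma_\sigma=\check\sigma$ for all $\sigma\in\Sigma$, and $\Gamma_\tau=\Gamma_\sigma+M(\tau,\Gamma_\sigma)$ for every face $\tau$ of $\sigma\in\Sigma$, where $M(\tau,\Gamma_\sigma)$ is the subgroup of $M$ generated by $\Gamma_\sigma\cap\tau^\perp$. Let $T^\Gamma_\Sigma$ be the (not necessarily normal) toric variety obtained by gluing the affine schemes $T^{\Gamma_\sigma}=\operatorname{Spec}k[t^{\Gamma_\sigma}]$, $\sigma\in\Sigma$, along the open subschemes $T^{\Gamma_{\sigma\cap\sigma'}}$ of $T^{\Gamma_\sigma}$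 and $T^{\Gamma_{\sigma'}}$. The logarithmic jacobian ideal $\mathcal J_\sigma\subset k[t^{\Gamma_\sigma}]$ is the ideal generated by the monomials $t^{\alpha_1+\dots+\alpha_d}$ with $\alpha_1,\dots,\alpha_d\in\Gamma_\sigma$ and $\alpha_1\wedge\dots\wedge\alpha_d\neq 0$; the ideals $\mathcal J_\sigma$ glue to the sheaf of logarithmic jacobian ideals $\mathcal J$ on $T^\Gamma_\Sigma$. Then: (a) The toric variety $T^\Gamma_\Sigma$ is nonsingular (all its local rings are regular) if and only if the blowing-up of $\mathcal J$ is an isomorphism. Here the blowing-up of $\mathcal J$ is the morphism $\pi\colon B\to T^\Gamma_\Sigma$, unique up to unique isomorphism, such that $\mathcal J\cdot\mathcal O_B$ is invertible (locally generated by one nonzerodivisor) and every morphism $g\colon T\to T^\Gamma_\Sigma$ of schemes with $\mathcal J\cdot\mathcal O_T$ invertible factors uniquely through $\pi$. (b) Let $\sigma\in\Sigma$ be a cone of dimension $d$ (equivalently, $\check\sigma$ is strictly convex). If the ideal $\mathcal J_\sigma$ is principal, then every minimal system of generators of the semigroup $\Gamma_\sigma$ has exactly $d$ elements, and $k[t^{\Gamma_\sigma}]$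 is isomorphic as a $k$-algebra to a polynomial ring in $d$ variables over $k$. -/

import Mathlib

open CategoryTheory CategoryTheory.Limits AlgebraicGeometry TensorProduct

namespace Toric

universe u v

noncomputable section

variable (N : Type v) [AddCommGroup N]

/-- The real vector space `N_ℝ = ℝ ⊗ N` of a lattice `N`. -/
abbrev RealSpace : Type v := ℝ ⊗[ℤ] N

/-- The lattice `M = Hom(N, ℤ)`. -/
abbrev DualLattice : Type v := Module.Dual ℤ N

variable {N}

/-- The real linear form `⟨·, m⟩` on `N_ℝ` given by `m ∈ M`; this is the embedding of `M` into
`M_ℝ`, the dual vector space of `N_ℝ`. -/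
def toReal : DualLattice N →+ Module.Dual ℝ (RealSpace N) where
  toFun m := Module.Dual.baseChange ℝ m
  map_zero' := map_zero _
  map_add' m m' := map_add _ m m'

@[simp]
lemma toReal_tmul (m : DualLattice N) (r : ℝ) (n : N) : toReal m (r ⊗ₜ n) = m n * r := by
  simp [toReal]

/-- `σ` is generated by finitely many elements of the lattice `N`. -/
def IsRationalPolyhedral (σ : PointedCone ℝ (RealSpace N)) : Prop :=
  ∃ S : Finset N, σ = PointedCone.hull ℝ ((fun n : N => (1 : ℝ) ⊗ₜ[ℤ] n) '' (S : Set N))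

/-- The dual cone `σ̌ ⊆ M_ℝ` of the linear forms that are nonnegative on `σ`. -/
def dualCone (σ : PointedCone ℝ (RealSpace N)) : PointedCone ℝ (Module.Dual ℝ (RealSpace N)) :=
  PointedCone.dual (Module.Dual.eval ℝ (RealSpace N)) (σ : Set (RealSpace N))

lemma mem_dualCone {σ : PointedCone ℝ (RealSpace N)} {u : Module.Dual ℝ (RealSpace N)} :
    u ∈ dualCone σ ↔ ∀ x ∈ σ, 0 ≤ u x := Iff.rfl

/-- `τ` is a face of `σ`: it is cut out of `σ` by a linear form that is nonnegative on `σ`. -/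
def IsFace (τ σ : PointedCone ℝ (RealSpace N)) : Prop :=
  ∃ u ∈ dualCone σ, ∀ x, x ∈ τ ↔ x ∈ σ ∧ u x = 0

lemma IsFace.le {τ σ : PointedCone ℝ (RealSpace N)} (h : IsFace τ σ) : τ ≤ σ := by
  obtain ⟨u, -, hu⟩ := h
  exact fun x hx => ((hu x).1 hx).1

variable (N) in
/-- A fan in `N_ℝ`: a finite set of strictly convex rational polyhedral cones, closed under taking
faces, in which any two cones meet along a common face. -/
structure Fan where
  cones : Finset (PointedCone ℝ (RealSpace N))
  rational : ∀ σ ∈ cones, IsRationalPolyhedral σ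
  strictlyConvex : ∀ σ ∈ cones, (σ : ConvexCone ℝ (RealSpace N)).Salient
  face_mem : ∀ σ ∈ cones, ∀ τ, IsFace τ σ → τ ∈ cones
  inter_isFace : ∀ σ ∈ cones, ∀ σ' ∈ cones, IsFace (σ ⊓ σ') σ ∧ IsFace (σ ⊓ σ') σ'

/-- The type of cones of a fan, ordered by inclusion. -/
abbrev Fan.Cone (Δ : Fan N) : Type v := {σ : PointedCone ℝ (RealSpace N) // σ ∈ Δ.cones}

/-- The elements of `Γ ∩ τ^⊥`. -/
def perpPart (Γ : AddSubmonoid (DualLattice N)) (τ : PointedCone ℝ (RealSpace N)) :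
    Set (DualLattice N) :=
  {m | m ∈ Γ ∧ ∀ x ∈ τ, toReal m x = 0}

/-- The subgroup `M(τ, Γ)` of `M` spanned by `Γ ∩ τ^⊥`. -/
def perpLattice (Γ : AddSubmonoid (DualLattice N)) (τ : PointedCone ℝ (RealSpace N)) :
    AddSubgroup (DualLattice N) :=
  AddSubgroup.closure (perpPart Γ τ)

variable (N) in
/-- The combinatorial data `(N, Σ, Γ)` of a not necessarily normal toric variety: a fan `Σ` in
`N_ℝ` and a family of finitely generated subsemigroups `Γ_σ` of `M` (`σ ∈ Σ`), with
`ℤ Γ_σ = M`, `ℝ_{≥ 0} Γ_σ = σ̌`, and `Γ_τ = Γ_σ + M(τ, Γ_σ)` for every face `τ` of `σ`. -/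
structure ToricDatum where
  fan : Fan N
  Γ : fan.Cone → AddSubmonoid (DualLattice N)
  fg : ∀ σ, (Γ σ).FG
  closure_eq_top : ∀ σ, AddSubgroup.closure (Γ σ : Set (DualLattice N)) = ⊤
  hull_eq : ∀ σ, PointedCone.hull ℝ (toReal '' (Γ σ : Set (DualLattice N))) = dualCone σ.1
  face_eq : ∀ σ τ : fan.Cone, IsFace τ.1 σ.1 →
    Γ τ = Γ σ ⊔ (perpLattice (Γ σ) τ.1).toAddSubmonoid

/-! ### Lattice points of rational cones -/

lemma exists_nsmul_mem_of_mem_hull [Module.Free ℤ N] [Module.Finite ℤ N]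
    (Γ : AddSubmonoid (DualLattice N)) (x : DualLattice N)
    (hx : toReal x ∈ PointedCone.hull ℝ (toReal '' (Γ : Set (DualLattice N)))) :
    ∃ n : ℕ, 0 < n ∧ n • x ∈ Γ := by
  classical
  obtain ⟨c, hc, hc0, hsum⟩ := PointedCone.mem_hull_set.1 hx
  choose! g hg hgr using fun y (hy : y ∈ c.support) => hc hy
  let b := Module.Free.chooseBasis ℤ N
  let q (k : ℕ) : DualLattice N := ∑ y ∈ c.support, ⌊(k : ℝ) * c y⌋₊ • g y
  have hval (n : N) : (x n : ℝ) = ∑ y ∈ c.support, c y * g y n := by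
    have h := congrArg (fun f : Module.Dual ℝ (RealSpace N) => f (1 ⊗ₜ n)) hsum
    simp only [toReal_tmul, mul_one] at h
    rw [← h, Finsupp.sum, LinearMap.sum_apply]
    refine Finset.sum_congr rfl fun y hy => ?_
    rw [LinearMap.smul_apply, smul_eq_mul]
    congr 1
    conv_lhs => rw [← hgr y hy]
    simp
  have hbd (k : ℕ) (n : N) : |(k • x - q k) n| ≤ ∑ y ∈ c.support, |g y n| := by
    have h1 : (((k • x - q k) n : ℤ) : ℝ) =
        ∑ y ∈ c.support, ((k : ℝ) * c y - ⌊(k : ℝ) * c y⌋₊) * g y n := by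
      simp only [q, LinearMap.sub_apply, LinearMap.smul_apply, LinearMap.sum_apply, nsmul_eq_mul,
        Int.cast_sub, Int.cast_mul, Int.cast_natCast, Int.cast_sum, hval, Finset.mul_sum]
      rw [← Finset.sum_sub_distrib]
      exact Finset.sum_congr rfl fun y _ => by ring
    have h2 : |(((k • x - q k) n : ℤ) : ℝ)| ≤ ∑ y ∈ c.support, |(g y n : ℝ)| := by
      rw [h1]
      refine (Finset.abs_sum_le_sum_abs _ _).trans (Finset.sum_le_sum fun y _ => ?_)
      rw [abs_mul]
      have h3 : 0 ≤ (k : ℝ) * c y := mul_nonneg k.cast_nonneg (hc0 y)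
      have h4 := Nat.floor_le h3
      have h5 := Nat.lt_floor_add_one ((k : ℝ) * c y)
      exact mul_le_of_le_one_left (abs_nonneg _) (abs_le.2 ⟨by linarith, by linarith⟩)
    exact_mod_cast h2
  let C (i : Module.Free.ChooseBasisIndex ℤ N) : ℤ := ∑ y ∈ c.support, |g y (b i)|
  let f (k : ℕ) : ∀ i, Set.Icc (-C i) (C i) := fun i => ⟨(k • x - q k) (b i), abs_le.1 (hbd k _)⟩
  obtain ⟨k, k', hne, hk⟩ := Finite.exists_ne_map_eq_of_infinite f
  wlog hlt : k < k' generalizing k k'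
  · exact this k' k hne.symm hk.symm (lt_of_le_of_ne (not_lt.1 hlt) hne.symm)
  refine ⟨k' - k, Nat.sub_pos_of_lt hlt, ?_⟩
  have heq : k • x - q k = k' • x - q k' :=
    b.ext fun i => congrArg Subtype.val (congrFun hk i)
  have hle (y) : ⌊(k : ℝ) * c y⌋₊ ≤ ⌊(k' : ℝ) * c y⌋₊ :=
    Nat.floor_mono (mul_le_mul_of_nonneg_right (by exact_mod_cast hlt.le) (hc0 y))
  have hfin : (k' - k) • x =
      ∑ y ∈ c.support, (⌊(k' : ℝ) * c y⌋₊ - ⌊(k : ℝ) * c y⌋₊) • g y := by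
    have h6 : q k' = q k + ∑ y ∈ c.support, (⌊(k' : ℝ) * c y⌋₊ - ⌊(k : ℝ) * c y⌋₊) • g y := by
      simp only [q]
      rw [← Finset.sum_add_distrib]
      refine Finset.sum_congr rfl fun y _ => ?_
      rw [← add_nsmul, Nat.add_sub_cancel' (hle y)]
    have h7 : k' • x = k • x + (k' - k) • x := by
      rw [← add_nsmul, Nat.add_sub_cancel' hlt.le]
    rw [h6, h7] at heq
    rw [sub_eq_sub_iff_add_eq_add] at heq
    have : k • x + q k + ∑ y ∈ c.support, (⌊(k' : ℝ) * c y⌋₊ - ⌊(k : ℝ) * c y⌋₊) • g y =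
        k • x + q k + (k' - k) • x := by
      rw [add_assoc, heq]; abel
    exact (add_left_cancel this).symm
  rw [hfin]
  exact sum_mem fun y hy => nsmul_mem (hg y hy) _

namespace ToricDatum

variable (D : ToricDatum N)

lemma nonneg (σ : D.fan.Cone) {m : DualLattice N} (hm : m ∈ D.Γ σ) {x : RealSpace N}
    (hx : x ∈ σ.1) : 0 ≤ toReal m x := by
  have h : toReal m ∈ dualCone σ.1 := by
    rw [← D.hull_eq σ]
    exact PointedCone.subset_hull ⟨m, hm, rfl⟩
  exact h hx

/-- Every face of `σ` is cut out by an element of `Γ_σ`. -/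
lemma exists_mem_face (σ : D.fan.Cone) {τ : PointedCone ℝ (RealSpace N)} (h : IsFace τ σ.1) :
    ∃ m ∈ D.Γ σ, ∀ x, x ∈ τ ↔ x ∈ σ.1 ∧ toReal m x = 0 := by
  obtain ⟨u, hu, hτ⟩ := h
  suffices ∃ m ∈ D.Γ σ, ∀ x ∈ σ.1, u x = 0 ↔ toReal m x = 0 by
    obtain ⟨m, hm, h⟩ := this
    exact ⟨m, hm, fun x => (hτ x).trans (and_congr_right (h x))⟩
  have hu' := hu
  rw [← D.hull_eq σ] at hu
  clear hτ hu'
  induction hu using Submodule.span_induction with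
  | mem _ h =>
    obtain ⟨m, hm, rfl⟩ := h
    exact ⟨m, hm, fun _ _ => Iff.rfl⟩
  | zero => exact ⟨0, zero_mem _, by simp⟩
  | add a b ha hb iha ihb =>
    obtain ⟨m, hm, h⟩ := iha
    obtain ⟨m', hm', h'⟩ := ihb
    refine ⟨m + m', add_mem hm hm', fun x hx => ?_⟩
    have ha0 : 0 ≤ a x := (D.hull_eq σ ▸ ha : a ∈ dualCone σ.1) hx
    have hb0 : 0 ≤ b x := (D.hull_eq σ ▸ hb : b ∈ dualCone σ.1) hx
    rw [map_add, LinearMap.add_apply, LinearMap.add_apply, add_eq_zero_iff_of_nonneg ha0 hb0,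
      add_eq_zero_iff_of_nonneg (D.nonneg σ hm hx) (D.nonneg σ hm' hx), h x hx, h' x hx]
  | smul c a ha ih =>
    obtain ⟨m, hm, h⟩ := ih
    by_cases hc : c = 0
    · exact ⟨0, zero_mem _, by simp [hc]⟩
    · refine ⟨m, hm, fun x hx => ?_⟩
      have hc' : (c : ℝ) ≠ 0 := fun h0 => hc (Subtype.ext h0)
      rw [← h x hx, show (c • a) x = (c : ℝ) * a x from rfl, mul_eq_zero, or_iff_right hc']

variable [Module.Free ℤ N] [Module.Finite ℤ N]

lemma exists_nsmul_sub_mem (σ : D.fan.Cone) {τ : PointedCone ℝ (RealSpace N)}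
    {m γ : DualLattice N} (hm : m ∈ D.Γ σ) (hτ : ∀ x, x ∈ τ ↔ x ∈ σ.1 ∧ toReal m x = 0)
    (hγ : γ ∈ perpPart (D.Γ σ) τ) : ∃ n : ℕ, n • m - γ ∈ D.Γ σ := by
  obtain ⟨S, hS⟩ := D.fan.rational σ.1 σ.2
  have hSσ (s : N) (hs : s ∈ S) : (1 : ℝ) ⊗ₜ[ℤ] s ∈ σ.1 := by
    rw [hS]; exact PointedCone.subset_hull ⟨s, hs, rfl⟩
  have h0 (δ : DualLattice N) (hδ : δ ∈ D.Γ σ) (s : N) (hs : s ∈ S) : 0 ≤ δ s := by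
    have h := D.nonneg σ hδ (hSσ s hs)
    rw [toReal_tmul, mul_one] at h
    exact_mod_cast h
  let k : ℕ := (∑ s ∈ S, γ s).toNat
  have hk (s : N) (hs : s ∈ S) : 0 ≤ (k • m - γ) s := by
    have hγs : γ s ≤ k := (Finset.single_le_sum (fun t ht => h0 γ hγ.1 t ht) hs).trans
      (Int.self_le_toNat _)
    rw [LinearMap.sub_apply, LinearMap.smul_apply, nsmul_eq_mul, sub_nonneg]
    rcases (h0 m hm s hs).eq_or_lt with h | h
    · have h1 : (1 : ℝ) ⊗ₜ[ℤ] s ∈ τ := (hτ _).2 ⟨hSσ s hs, by simp [← h]⟩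
      have h2 := hγ.2 _ h1
      rw [toReal_tmul, mul_one] at h2
      have h3 : γ s = 0 := by exact_mod_cast h2
      rw [h3, ← h, mul_zero]
    · nlinarith [Int.natCast_nonneg k]
  have hd : toReal (k • m - γ) ∈ dualCone σ.1 := by
    rw [mem_dualCone]
    intro x hx
    rw [hS] at hx
    induction hx using Submodule.span_induction with
    | mem _ h =>
      obtain ⟨s, hs, rfl⟩ := h
      rw [toReal_tmul, mul_one]
      exact_mod_cast hk s hs
    | zero => rw [map_zero]
    | add a b _ _ ha hb => rw [map_add]; exact add_nonneg ha hb
    | smul c a _ ha =>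
      rw [show c • a = (c : ℝ) • a from rfl, map_smul]
      exact mul_nonneg c.2 ha
  rw [← D.hull_eq σ] at hd
  obtain ⟨n, hn, h⟩ := exists_nsmul_mem_of_mem_hull _ _ hd
  refine ⟨n * k, ?_⟩
  have e : (n * k) • m - γ = n • (k • m - γ) + (n - 1) • γ := by
    obtain ⟨p, rfl⟩ := Nat.exists_eq_add_of_le' hn
    rw [Nat.add_sub_cancel, mul_nsmul', nsmul_sub, add_nsmul, add_nsmul, one_nsmul]
    simp only [one_nsmul]
    abel
  rw [e]
  exact add_mem h (nsmul_mem hγ.1 _)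

/-- For a face `τ` of `σ` cut out by `m ∈ Γ_σ` one has `Γ_τ = Γ_σ + ℤ_{≥ 0} (-m)`. -/
lemma exists_add_nsmul_mem (σ τ : D.fan.Cone) {m : DualLattice N} (hm : m ∈ D.Γ σ)
    (hτ : ∀ x, x ∈ τ.1 ↔ x ∈ σ.1 ∧ toReal m x = 0) :
    D.Γ σ ≤ D.Γ τ ∧ -m ∈ D.Γ τ ∧ ∀ γ ∈ D.Γ τ, ∃ n : ℕ, γ + n • m ∈ D.Γ σ := by
  have hmσ : toReal m ∈ dualCone σ.1 := fun x hx => D.nonneg σ hm hx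
  have hface : IsFace τ.1 σ.1 := ⟨toReal m, hmσ, hτ⟩
  have he := D.face_eq σ τ hface
  have hmp : m ∈ perpPart (D.Γ σ) τ.1 := ⟨hm, fun x hx => ((hτ x).1 hx).2⟩
  refine ⟨he ▸ le_sup_left, ?_, fun γ hγ => ?_⟩
  · rw [he]
    exact (le_sup_right : _ ≤ D.Γ σ ⊔ _) 
      ((perpLattice (D.Γ σ) τ.1).neg_mem (AddSubgroup.subset_closure hmp))
  · rw [he] at hγ
    obtain ⟨a, ha, b, hb, rfl⟩ := AddSubmonoid.mem_sup.1 hγ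
    suffices ∃ n : ℕ, b + n • m ∈ D.Γ σ by
      obtain ⟨n, hn⟩ := this
      exact ⟨n, by rw [add_assoc]; exact add_mem ha hn⟩
    have hb' : b ∈ AddSubgroup.closure (perpPart (D.Γ σ) τ.1) := hb
    clear hb hγ
    have hP : ∀ b ∈ AddSubgroup.closure (perpPart (D.Γ σ) τ.1),
        (∃ n : ℕ, b + n • m ∈ D.Γ σ) ∧ ∃ n : ℕ, -b + n • m ∈ D.Γ σ := by
      intro b hb
      induction hb using AddSubgroup.closure_induction with
      | mem x hx =>
        refine ⟨⟨0, by simpa using hx.1⟩, ?_⟩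
        obtain ⟨n, hn⟩ := D.exists_nsmul_sub_mem σ hm hτ hx
        exact ⟨n, by rwa [neg_add_eq_sub]⟩
      | zero => exact ⟨⟨0, by simp⟩, ⟨0, by simp⟩⟩
      | add x y _ _ hx hy =>
        obtain ⟨⟨n, hn⟩, ⟨n', hn'⟩⟩ := hx
        obtain ⟨⟨l, hl⟩, ⟨l', hl'⟩⟩ := hy
        refine ⟨⟨n + l, ?_⟩, ⟨n' + l', ?_⟩⟩
        · have := add_mem hn hl
          rwa [show x + n • m + (y + l • m) = x + y + (n + l) • m by rw [add_nsmul]; abel] at this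
        · have := add_mem hn' hl'
          rwa [show -x + n' • m + (-y + l' • m) = -(x + y) + (n' + l') • m by
            rw [add_nsmul]; abel] at this
      | neg x _ hx => exact ⟨hx.2, by simpa using hx.1⟩
    exact (hP b hb').1


end ToricDatum

/-! ### Semigroup algebras -/

section SemigroupAlgebra

variable (k : Type u) [Field k]

/-- The map of semigroup algebras `k[t^Γ] → k[t^Γ']` given by an inclusion `Γ ⊆ Γ'`. -/
def semigroupAlgebraMap {Γ Γ' : AddSubmonoid (DualLattice N)} (h : Γ ≤ Γ') :
    AddMonoidAlgebra k Γ →+* AddMonoidAlgebra k Γ' :=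
  AddMonoidAlgebra.mapDomainRingHom k (AddSubmonoid.inclusion h)

variable {k}

lemma semigroupAlgebraMap_single {Γ Γ' : AddSubmonoid (DualLattice N)} (h : Γ ≤ Γ') (m : Γ)
    (a : k) : semigroupAlgebraMap k h (AddMonoidAlgebra.single m a) =
      AddMonoidAlgebra.single (AddSubmonoid.inclusion h m) a := by
  simp [semigroupAlgebraMap]

lemma semigroupAlgebraMap_injective {Γ Γ' : AddSubmonoid (DualLattice N)} (h : Γ ≤ Γ') :
    Function.Injective (semigroupAlgebraMap k h) :=
  AddMonoidAlgebra.mapDomain_injective (AddSubmonoid.inclusion_injective h)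

lemma isLocalizationAway {Γ Γ' : AddSubmonoid (DualLattice N)} (h : Γ ≤ Γ') (m : Γ)
    (hm : -(m : DualLattice N) ∈ Γ') (hΓ : ∀ γ ∈ Γ', ∃ n : ℕ, γ + n • (m : DualLattice N) ∈ Γ) :
    letI := (semigroupAlgebraMap k h).toAlgebra
    IsLocalization.Away (AddMonoidAlgebra.single m (1 : k)) (AddMonoidAlgebra k Γ') := by
  let := (semigroupAlgebraMap k h).toAlgebra
  have halg : algebraMap (AddMonoidAlgebra k Γ) (AddMonoidAlgebra k Γ') =
    semigroupAlgebraMap k h := rfl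
  refine IsLocalization.Away.mk _ ?_ ?_ ?_
  · rw [halg, semigroupAlgebraMap_single]
    refine IsUnit.of_mul_eq_one (AddMonoidAlgebra.single ⟨_, hm⟩ 1) ?_
    rw [AddMonoidAlgebra.single_mul_single, AddMonoidAlgebra.one_def, mul_one]
    congr 1
    exact Subtype.ext (by simp)
  · intro z
    rw [halg, semigroupAlgebraMap_single]
    induction z using AddMonoidAlgebra.induction_linear with
    | zero => exact ⟨0, 0, by simp⟩
    | add f g hf hg =>
      obtain ⟨n, a, ha⟩ := hf
      obtain ⟨l, b, hb⟩ := hg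
      refine ⟨n + l, a * AddMonoidAlgebra.single m 1 ^ l + b * AddMonoidAlgebra.single m 1 ^ n, ?_⟩
      simp only [map_add, map_mul, map_pow, semigroupAlgebraMap_single]
      rw [← ha, ← hb]
      ring
    | single γ a =>
      obtain ⟨n, hn⟩ := hΓ γ γ.2
      refine ⟨n, AddMonoidAlgebra.single ⟨_, hn⟩ a, ?_⟩
      rw [semigroupAlgebraMap_single, AddMonoidAlgebra.single_pow, one_pow,
        AddMonoidAlgebra.single_mul_single, mul_one]
      congr 1
  · intro a b hab
    exact ⟨0, by rw [semigroupAlgebraMap_injective h hab]⟩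

end SemigroupAlgebra

namespace ToricDatum

variable (k : Type u) [Field k] (D : ToricDatum N)

lemma isFace_of_le {D : ToricDatum N} {σ τ : D.fan.Cone} (h : τ ≤ σ) : IsFace τ.1 σ.1 := by
  have := (D.fan.inter_isFace σ.1 σ.2 τ.1 τ.2).1
  rwa [inf_eq_right.2 h] at this

lemma Γ_anti {D : ToricDatum N} {σ τ : D.fan.Cone} (h : τ ≤ σ) : D.Γ σ ≤ D.Γ τ :=
  D.face_eq σ τ (isFace_of_le h) ▸ le_sup_left

/-- The affine toric variety `T^{Γ_σ} = Spec k[t^{Γ_σ}]`. -/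
abbrev chart (σ : D.fan.Cone) : Scheme.{max u v} :=
  Spec (CommRingCat.of (AddMonoidAlgebra k (D.Γ σ)))

/-- The diagram of the affine toric varieties `T^{Γ_σ}`, for `σ ∈ Σ`, with the morphisms
`T^{Γ_τ} → T^{Γ_σ}` given by `Γ_σ ⊆ Γ_τ` for `τ ≤ σ`. -/
def diagram : D.fan.Cone ⥤ Scheme.{max u v} where
  obj σ := D.chart k σ
  map f := Spec.map (CommRingCat.ofHom (semigroupAlgebraMap k (Γ_anti (leOfHom f))))
  map_id σ := by
    rw [← Spec.map_id]
    exact congrArg (fun g => Spec.map (CommRingCat.ofHom g))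
      (AddMonoidAlgebra.mapDomainRingHom_id (R := k) (M := D.Γ σ))
  map_comp f g := by
    rw [← Spec.map_comp, ← CommRingCat.ofHom_comp]
    exact congrArg (fun g => Spec.map (CommRingCat.ofHom g))
      (AddMonoidAlgebra.mapDomainRingHom_comp (R := k)
        (AddSubmonoid.inclusion (Γ_anti (leOfHom f))) (AddSubmonoid.inclusion (Γ_anti (leOfHom g))))

lemma exists_cutOut (σ τ : D.fan.Cone) (h : τ ≤ σ) :
    ∃ m : D.Γ σ, (∀ x, x ∈ τ.1 ↔ x ∈ σ.1 ∧ toReal (m : DualLattice N) x = 0) := by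
  obtain ⟨m, hm, hτ⟩ := D.exists_mem_face σ (isFace_of_le h)
  exact ⟨⟨m, hm⟩, hτ⟩

variable [Module.Free ℤ N] [Module.Finite ℤ N]

lemma isLocalizationAway_of_face {σ τ : D.fan.Cone} (h : τ ≤ σ) (m : D.Γ σ)
    (hτ : ∀ x, x ∈ τ.1 ↔ x ∈ σ.1 ∧ toReal (m : DualLattice N) x = 0) :
    letI := (semigroupAlgebraMap k (Γ_anti h)).toAlgebra
    IsLocalization.Away (AddMonoidAlgebra.single m (1 : k)) (AddMonoidAlgebra k (D.Γ τ)) :=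
  isLocalizationAway _ m (D.exists_add_nsmul_mem σ τ m.2 hτ).2.1
    (D.exists_add_nsmul_mem σ τ m.2 hτ).2.2

instance {σ τ : D.fan.Cone} (f : τ ⟶ σ) : IsOpenImmersion ((D.diagram k).map f) := by
  obtain ⟨m, hτ⟩ := D.exists_cutOut σ τ (leOfHom f)
  let := (semigroupAlgebraMap k (Γ_anti (leOfHom f))).toAlgebra
  have := D.isLocalizationAway_of_face k (leOfHom f) m hτ
  exact IsOpenImmersion.of_isLocalization (AddMonoidAlgebra.single m (1 : k))

lemma range_diagram_map {σ τ : D.fan.Cone} (f : τ ⟶ σ) (m : D.Γ σ)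
    (hτ : ∀ x, x ∈ τ.1 ↔ x ∈ σ.1 ∧ toReal (m : DualLattice N) x = 0) (p : D.chart k σ) :
    (∃ q : D.chart k τ, (D.diagram k).map f q = p) ↔
      AddMonoidAlgebra.single m (1 : k) ∉ p.asIdeal := by
  let := (semigroupAlgebraMap k (Γ_anti (leOfHom f))).toAlgebra
  have := D.isLocalizationAway_of_face k (leOfHom f) m hτ
  have h := PrimeSpectrum.localization_away_comap_range (AddMonoidAlgebra k (D.Γ τ))
    (AddMonoidAlgebra.single m (1 : k))
  exact Set.ext_iff.1 h p

instance : (D.diagram k ⋙ Scheme.forget).IsLocallyDirected where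
  cond {τ₁ τ₂ σ} f₁ f₂ x₁ x₂ hx := by
    have hx' : (D.diagram k).map f₁ x₁ = (D.diagram k).map f₂ x₂ := hx
    let τ : D.fan.Cone := ⟨τ₁.1 ⊓ τ₂.1, D.fan.face_mem τ₁.1 τ₁.2 _
      (D.fan.inter_isFace τ₁.1 τ₁.2 τ₂.1 τ₂.2).1⟩
    let g₁ : τ ⟶ τ₁ := homOfLE (inf_le_left : τ₁.1 ⊓ τ₂.1 ≤ τ₁.1)
    let g₂ : τ ⟶ τ₂ := homOfLE (inf_le_right : τ₁.1 ⊓ τ₂.1 ≤ τ₂.1)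
    obtain ⟨m₁, h₁⟩ := D.exists_cutOut σ τ₁ (leOfHom f₁)
    obtain ⟨m₂, h₂⟩ := D.exists_cutOut σ τ₂ (leOfHom f₂)
    have h (x) : x ∈ τ.1 ↔ x ∈ σ.1 ∧ toReal ((m₁ + m₂ : D.Γ σ) : DualLattice N) x = 0 := by
      rw [show x ∈ τ.1 ↔ x ∈ τ₁.1 ∧ x ∈ τ₂.1 from Iff.rfl, h₁, h₂, ← and_and_left]
      refine and_congr_right fun hx => ?_
      rw [AddSubmonoid.coe_add, map_add, LinearMap.add_apply,
        add_eq_zero_iff_of_nonneg (D.nonneg σ m₁.2 hx) (D.nonneg σ m₂.2 hx)]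
    have e₁ := (D.range_diagram_map k f₁ m₁ h₁ _).1 ⟨x₁, rfl⟩
    have e₂ := (D.range_diagram_map k f₂ m₂ h₂ _).1 ⟨x₂, rfl⟩
    rw [← hx'] at e₂
    obtain ⟨z, hz⟩ := (D.range_diagram_map k (g₁ ≫ f₁) (m₁ + m₂) h ((D.diagram k).map f₁ x₁)).2
      (by
        intro hmem
        rw [show AddMonoidAlgebra.single (m₁ + m₂) (1 : k) = AddMonoidAlgebra.single m₁ 1 *
          AddMonoidAlgebra.single m₂ 1 by rw [AddMonoidAlgebra.single_mul_single, mul_one]] at hmem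
        exact (Ideal.IsPrime.mem_or_mem (PrimeSpectrum.isPrime _) hmem).elim e₁ e₂)
    refine ⟨τ, g₁, g₂, z, ?_, ?_⟩
    · apply ((D.diagram k).map f₁).isOpenEmbedding.injective
      refine Eq.trans ?_ hz
      exact congrArg (fun φ : (D.diagram k).obj τ ⟶ (D.diagram k).obj σ => φ z)
        ((D.diagram k).map_comp g₁ f₁).symm
    · apply ((D.diagram k).map f₂).isOpenEmbedding.injective
      refine Eq.trans ?_ (hz.trans hx')
      exact congrArg (fun φ : (D.diagram k).obj τ ⟶ (D.diagram k).obj σ => φ z)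
        ((D.diagram k).map_comp g₂ f₂).symm

/-- The toric variety `T^Γ_Σ` over `k`: the scheme obtained from the affine toric varieties
`T^{Γ_σ}`, `σ ∈ Σ`, by gluing `T^{Γ_σ}` and `T^{Γ_σ'}` along their common open subscheme
`T^{Γ_{σ ∩ σ'}}`, for all `σ, σ' ∈ Σ`. -/
def toricVariety : Scheme.{max u v} := colimit (D.diagram k)

/-- The open immersion of the chart `T^{Γ_σ}` into `T^Γ_Σ`. -/
def chartMap (σ : D.fan.Cone) : D.chart k σ ⟶ D.toricVariety k := colimit.ι (D.diagram k) σ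

instance (σ : D.fan.Cone) : IsOpenImmersion (D.chartMap k σ) :=
  inferInstanceAs (IsOpenImmersion (colimit.ι (D.diagram k) σ))

/-- The logarithmic jacobian ideal `J_σ` of `k[t^{Γ_σ}]`, generated by the monomials
`t^{α_1 + ⋯ + α_d}` with `α_1, …, α_d ∈ Γ_σ` linearly independent, i.e. `α_1 ∧ ⋯ ∧ α_d ≠ 0`, where
`d` is the rank of `M`, that is, of `N`. -/
def logJacobianIdeal (σ : D.fan.Cone) : Ideal (AddMonoidAlgebra k (D.Γ σ)) :=
  Ideal.span {f | ∃ α : Fin (Module.finrank ℤ N) → D.Γ σ,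
    LinearIndependent ℤ (fun i => (α i : DualLattice N)) ∧
      f = AddMonoidAlgebra.single (∑ i, α i) 1}

/-- The ideal sheaf on the chart `T^{Γ_σ}` given by the logarithmic jacobian ideal `J_σ`. -/
def chartLogJacobian (σ : D.fan.Cone) : (D.chart k σ).IdealSheafData :=
  Scheme.IdealSheafData.ofIdealTop ((D.logJacobianIdeal k σ).map
    (Scheme.ΓSpecIso (CommRingCat.of (AddMonoidAlgebra k (D.Γ σ)))).inv.hom)

/-- The sheaf of logarithmic jacobian ideals on `T^Γ_Σ`, glued from the ideals `J_σ`: its sections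
are the functions whose restriction to each chart `T^{Γ_σ}` lies in `J_σ`. -/
def logJacobian : (D.toricVariety k).IdealSheafData :=
  ⨅ σ, (D.chartLogJacobian k σ).map (D.chartMap k σ)

end ToricDatum

/-! ### Nonsingular schemes and blowing-ups -/

/-- A scheme is nonsingular if all its local rings are regular. -/
def IsNonsingular (X : Scheme.{u}) : Prop :=
  ∀ x : X, IsRegularLocalRing (X.presheaf.stalk x)

/-- An ideal sheaf is invertible if it is locally generated by one nonzerodivisor. -/
def IsInvertible {X : Scheme.{u}} (I : X.IdealSheafData) : Prop :=
  ∀ x : X, ∃ U : X.affineOpens, x ∈ U.1 ∧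
    ∃ f ∈ nonZeroDivisors Γ(X, U.1), I.ideal U = Ideal.span {f}

/-- `π : B ⟶ X` is the blowing-up of the ideal sheaf `J`: the inverse image ideal sheaf `J · 𝒪_B`
is invertible, and every morphism `g : T ⟶ X` for which `J · 𝒪_T` is invertible factors uniquely
through `π`. These conditions determine `π` up to a unique isomorphism over `X`. -/
structure IsBlowUp {X B : Scheme.{u}} (J : X.IdealSheafData) (π : B ⟶ X) : Prop where
  invertible : IsInvertible (J.comap π)
  existsUnique_fac : ∀ (T : Scheme.{u}) (g : T ⟶ X), IsInvertible (J.comap g) →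
    ∃! h : T ⟶ B, h ≫ π = g

end

end Toric

/-! Both sides of (a) are equivalent to one combinatorial condition, `IsSmooth`: every `Γ_σ` is
generated by a basis of `M` and the opposites of some of its vectors. The universal property makes a
blowing-up of `J` an isomorphism exactly when `J` is invertible (`IsBlowUp.isIso_iff`), so the two
equivalences to prove are `isInvertible_logJacobian_iff` and `isNonsingular_iff`.

If `Γ` is smooth, `k[t^Γ]` is a polynomial ring with some variables inverted, hence a regular
domain, and its jacobian ideal is generated by the monomial whose exponent is the sum of the basis.

The converses are tested at the distinguished point of a chart, where units of `Γ` take the value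
`1` and the other monomials vanish. If `J` is principal there, one of its monomials `t^(∑ α_i)`
generates it. Elements outside the maximal ideal involve a unit monomial, so `∑ β_i - ∑ α_i ∈ Γ` for
every independent family `β` (`exists_sum_sub_mem_of_isPrincipal`). Exchanging a single `α_i` for
`g` gives `g - α_i ∈ Γ`, from which the units and the nonunit `α_i` generate `Γ` without further
relations (`isSmooth_of_sum_sub_mem`).

If the local ring there is regular, its embedding dimension is at most `d`. Tangent vectors attached
to a basis of the units and to the irreducibles modulo units are independent, in every
characteristic; hence these at most `d` elements, which generate `M`, form a basis
(`isSmooth_of_isRegularLocalRing`).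

For (b), a cone of full dimension has no nonzero units in `Γ_σ`, so smoothness makes `Γ_σ` a free
commutative monoid. -/

namespace Toric

/-! ### Units, generators and smoothness of subsemigroups of a lattice. -/

section Semigroups

variable {M : Type*} [AddCommGroup M]

/-- The group of units of a subsemigroup `Γ` of `M`. -/
def unitGroup (Γ : AddSubmonoid M) : AddSubgroup M where
  carrier := {m | m ∈ Γ ∧ -m ∈ Γ}
  zero_mem' := by simp
  add_mem' ha hb := ⟨add_mem ha.1 hb.1, by rw [neg_add]; exact add_mem ha.2 hb.2⟩
  neg_mem' ha := ⟨ha.2, by simpa using ha.1⟩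

lemma mem_unitGroup_of_add {Γ : AddSubmonoid M} {a b : M} (ha : a ∈ Γ) (hb : b ∈ Γ)
    (h : a + b ∈ unitGroup Γ) : a ∈ unitGroup Γ := by
  refine ⟨ha, ?_⟩
  rw [show -a = b + -(a + b) by abel]
  exact add_mem hb h.2

lemma add_mem_unitGroup_iff {Γ : AddSubmonoid M} {a b : M} (ha : a ∈ Γ) (hb : b ∈ Γ) :
    a + b ∈ unitGroup Γ ↔ a ∈ unitGroup Γ ∧ b ∈ unitGroup Γ :=
  ⟨fun h => ⟨mem_unitGroup_of_add ha hb h, mem_unitGroup_of_add hb ha (add_comm a b ▸ h)⟩,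
    fun h => add_mem h.1 h.2⟩

lemma mem_unitGroup_of_zsmul {Γ : AddSubmonoid M} {a : M} (ha : a ∈ Γ) {n : ℤ} (hn : n ≠ 0)
    (h : n • a ∈ unitGroup Γ) : a ∈ unitGroup Γ := by
  have h' : n.natAbs • a ∈ unitGroup Γ := by
    rcases Int.natAbs_eq n with e | e
    · rwa [e, natCast_zsmul] at h
    · rw [e, neg_smul, natCast_zsmul] at h
      simpa using neg_mem h
  obtain ⟨p, hp⟩ := Nat.exists_eq_succ_of_ne_zero (Int.natAbs_ne_zero.2 hn)
  rw [hp, Nat.succ_eq_add_one, add_nsmul, one_nsmul, add_comm] at h'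
  exact mem_unitGroup_of_add ha (nsmul_mem ha _) h'

/-- `Γ` carries a grading by the natural numbers whose part of degree `0` is the unit group. -/
def IsGraded (Γ : AddSubmonoid M) : Prop :=
  ∃ l : M →+ ℤ, ∀ γ ∈ Γ, 0 ≤ l γ ∧ (l γ = 0 → -γ ∈ Γ)

/-- The degree is additive and strictly positive on nonunits, so removing a nonunit summand lowers
it: this replaces induction on length and tolerates units. -/
lemma IsGraded.induction {Γ : AddSubmonoid M} (hΓ : IsGraded Γ) {P : M → Prop}
    (unit : ∀ γ ∈ unitGroup Γ, P γ)
    (step : ∀ γ ∈ Γ, γ ∉ unitGroup Γ →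
      (∀ δ ∈ Γ, γ - δ ∈ Γ → γ - δ ∉ unitGroup Γ → P δ) → P γ) : ∀ γ ∈ Γ, P γ := by
  obtain ⟨l, hl⟩ := hΓ
  intro γ hγ
  induction hn : (l γ).toNat using Nat.strong_induction_on generalizing γ with
  | _ n ih =>
    by_cases hu : γ ∈ unitGroup Γ
    · exact unit γ hu
    refine step γ hγ hu fun δ hδ hs hns => ih (l δ).toNat ?_ δ hδ rfl
    have h1 : 0 < l (γ - δ) :=
      lt_of_le_of_ne (hl _ hs).1 fun h => hns ⟨hs, (hl _ hs).2 h.symm⟩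
    rw [map_sub] at h1
    have := (hl δ hδ).1
    omega

/-- The elements of `Γ` that are not units and not sums of two nonunits. -/
def irreducibles (Γ : AddSubmonoid M) : Set M :=
  {γ | γ ∈ Γ ∧ γ ∉ unitGroup Γ ∧
    ∀ a ∈ Γ, ∀ b ∈ Γ, γ = a + b → a ∈ unitGroup Γ ∨ b ∈ unitGroup Γ}

lemma IsGraded.le_closure_irreducibles {Γ : AddSubmonoid M} (hΓ : IsGraded Γ) :
    Γ ≤ AddSubmonoid.closure (unitGroup Γ ∪ irreducibles Γ) := by
  refine hΓ.induction (fun γ hγ => AddSubmonoid.subset_closure (Or.inl hγ)) ?_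
  intro γ hγ hu ih
  by_cases hi : γ ∈ irreducibles Γ
  · exact AddSubmonoid.subset_closure (Or.inr hi)
  · simp only [irreducibles, Set.mem_ofPred_eq, not_and, not_forall, not_or] at hi
    obtain ⟨a, ha, b, hb, rfl, hau, hbu⟩ := hi hγ hu
    exact add_mem (ih a ha (by simpa using hb) (by simpa using hbu))
      (ih b hb (by simpa using ha) (by simpa using hau))

lemma IsGraded.le_closure_of_descent {Γ : AddSubmonoid M} (hΓ : IsGraded Γ) {G : Set M}
    (hG : ∀ g ∈ G, g ∈ Γ ∧ g ∉ unitGroup Γ)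
    (h : ∀ γ ∈ Γ, γ ∉ unitGroup Γ → ∃ g ∈ G, γ - g ∈ Γ) :
    Γ ≤ AddSubmonoid.closure (unitGroup Γ ∪ G) := by
  refine hΓ.induction (fun γ hγ => AddSubmonoid.subset_closure (Or.inl hγ)) ?_
  intro γ hγ hu ih
  obtain ⟨g, hg, hs⟩ := h γ hγ hu
  have h1 := ih (γ - g) hs
  rw [sub_sub_cancel] at h1
  have := add_mem (h1 (hG g hg).1 (hG g hg).2) (AddSubmonoid.subset_closure (Or.inr hg))
  rwa [sub_add_cancel] at this

lemma span_eq_top_of_le_closure {Γ : AddSubmonoid M} (hM : AddSubgroup.closure (Γ : Set M) = ⊤)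
    {S : Set M} (hS : Γ ≤ AddSubmonoid.closure S) : Submodule.span ℤ S = ⊤ := by
  rw [← Submodule.toAddSubgroup_inj, Submodule.span_int_eq_addSubgroupClosure]
  refine eq_top_iff.2 ?_
  rw [← hM, AddSubgroup.closure_le]
  intro x hx
  exact (AddSubmonoid.closure_le (S := (AddSubgroup.closure S).toAddSubmonoid)).2
    AddSubgroup.subset_closure (hS hx)

lemma span_range_basis_unitGroup {Γ : AddSubmonoid M} {κ : Type*}
    (f : Module.Basis κ ℤ (unitGroup Γ).toIntSubmodule) :
    Submodule.span ℤ (Set.range fun i => (f i : M)) = (unitGroup Γ).toIntSubmodule := by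
  rw [show (fun i => (f i : M)) = (unitGroup Γ).toIntSubmodule.subtype ∘ f from rfl,
    Set.range_comp, Submodule.span_image, f.span_eq, Submodule.map_top, Submodule.range_subtype]

lemma span_sumElim_eq {Γ : AddSubmonoid M} {κ ρ : Type*}
    (f : Module.Basis κ ℤ (unitGroup Γ).toIntSubmodule) (g : ρ → M) :
    Submodule.span ℤ (Set.range (Sum.elim (fun i => (f i : M)) g)) =
      Submodule.span ℤ (unitGroup Γ ∪ Set.range g) := by
  rw [Set.Sum.elim_range, Submodule.span_union, Submodule.span_union, span_range_basis_unitGroup]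
  congr 1
  exact (Submodule.span_eq (unitGroup Γ).toIntSubmodule).symm


/-- Cramer's rule without denominators: `Δ` is the determinant of `α` in the basis `b` and the `D i`
are given by the rows of the adjugate matrix. -/
lemma exists_coordinates {ι : Type*} [Fintype ι] [DecidableEq ι] (b : Module.Basis ι ℤ M)
    {α : ι → M} (hα : LinearIndependent ℤ α) :
    ∃ (Δ : ℤ) (D : ι → M →ₗ[ℤ] ℤ), Δ ≠ 0 ∧ (∀ i j, D i (α j) = if i = j then Δ else 0) ∧
      ∀ g, Δ • g = ∑ i, D i g • α i := by
  let A : Matrix ι ι ℤ := b.toMatrix α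
  refine ⟨A.det, fun i => LinearMap.proj i ∘ₗ A.adjugate.mulVecLin ∘ₗ b.equivFun.toLinearMap,
    ?_, ?_, ?_⟩
  · intro h
    obtain ⟨v, hv, hv0⟩ := Matrix.exists_mulVec_eq_zero_iff.2 h
    refine hv (funext (Fintype.linearIndependent_iff.1 hα v ?_))
    refine b.equivFun.injective (funext fun j => ?_)
    have := congrFun hv0 j
    simpa [A, Matrix.mulVec, dotProduct, Module.Basis.toMatrix_apply, mul_comm] using this
  · intro i j
    have h : b.equivFun (α j) = A.mulVec (Pi.single j 1) := by
      ext l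
      simp [A, Module.Basis.toMatrix_apply]
    simp only [LinearMap.comp_apply, LinearEquiv.coe_coe, h, Matrix.mulVecLin_apply,
      Matrix.mulVec_mulVec, Matrix.adjugate_mul]
    rw [Matrix.smul_mulVec, Matrix.one_mulVec]
    simp [Pi.single_apply]
  · intro g
    refine b.equivFun.injective (funext fun j => ?_)
    have := congrFun (Matrix.mulVec_mulVec (b.equivFun g) A A.adjugate) j
    rw [Matrix.mul_adjugate, Matrix.smul_mulVec, Matrix.one_mulVec] at this
    rw [map_smul, ← this, map_sum, Finset.sum_apply]
    simp [A, Matrix.mulVec, dotProduct, Module.Basis.toMatrix_apply, mul_comm]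

lemma linearIndependent_update {ι : Type*} [Fintype ι] [DecidableEq ι] {α : ι → M} {Δ : ℤ}
    {D : ι → M →ₗ[ℤ] ℤ} (hΔ : Δ ≠ 0) (hD : ∀ i j, D i (α j) = if i = j then Δ else 0) {i : ι}
    {g : M} (hg : D i g ≠ 0) : LinearIndependent ℤ (Function.update α i g) := by
  rw [Fintype.linearIndependent_iff]
  intro c hc
  have hi : c i = 0 := by
    have h := congrArg (D i) hc
    rw [map_sum, map_zero, Finset.sum_eq_single i] at h
    · simpa [hg] using h
    · intro j _ hj
      simp [Function.update_of_ne hj, hD, hj.symm]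
    · simp
  intro j
  by_cases hj : j = i
  · rw [hj, hi]
  · have h := congrArg (D j) hc
    rw [map_sum, map_zero, Finset.sum_eq_single j] at h
    · simpa [Function.update_of_ne hj, hD, hΔ] using h
    · intro l _ hl
      by_cases hli : l = i
      · simp [hli, hi]
      · simp [Function.update_of_ne hli, hD, hl.symm]
    · simp

/-- `Γ` is generated by a basis of the lattice `M` and the opposites of some vectors of this
basis. -/
def IsSmooth (Γ : AddSubmonoid M) : Prop :=
  ∃ (b : Module.Basis (Fin (Module.finrank ℤ M)) ℤ M) (I : Set (Fin (Module.finrank ℤ M))),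
    ∀ γ, γ ∈ Γ ↔ ∀ i ∈ I, 0 ≤ b.repr γ i

/-- Generation makes the independent family a basis of `M`. The coordinates along `g` vanish on
units, so their nonnegativity is what cuts out `Γ`. -/
lemma isSmooth_of_linearIndependent {Γ : AddSubmonoid M}
    (hM : AddSubgroup.closure (Γ : Set M) = ⊤) {κ ρ : Type*} [Finite κ] [Finite ρ]
    (f : Module.Basis κ ℤ (unitGroup Γ).toIntSubmodule) (g : ρ → M) (hg : ∀ j, g j ∈ Γ)
    (hgen : Γ ≤ AddSubmonoid.closure (unitGroup Γ ∪ Set.range g))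
    (hli : LinearIndependent ℤ (Sum.elim (fun i => (f i : M)) g)) : IsSmooth Γ := by
  classical
  cases nonempty_fintype κ
  cases nonempty_fintype ρ
  have hspan := span_eq_top_of_le_closure hM hgen
  rw [← span_sumElim_eq f g] at hspan
  let b := Module.Basis.mk hli hspan.ge
  have hbl (i) : b (Sum.inl i) = f i := by simp [b]
  have hbr (j) : b (Sum.inr j) = g j := by simp [b]
  have hu (u : M) (hu : u ∈ unitGroup Γ) (j : ρ) : b.repr u (Sum.inr j) = 0 := by
    have hle : (unitGroup Γ).toIntSubmodule ≤ LinearMap.ker (b.coord (Sum.inr j)) := by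
      rw [← span_range_basis_unitGroup f, Submodule.span_le]
      rintro _ ⟨i, rfl⟩
      simp only [SetLike.mem_coe, LinearMap.mem_ker, ← hbl]
      simp
    exact hle hu
  have key (γ : M) : γ ∈ Γ ↔ ∀ j : ρ, 0 ≤ b.repr γ (Sum.inr j) := by
    constructor
    · intro hγ j
      replace hγ := hgen hγ
      induction hγ using AddSubmonoid.closure_induction with
      | mem x hx =>
        rcases hx with hx | ⟨i, rfl⟩
        · rw [hu x hx]
        · rw [← hbr]
          simp only [Module.Basis.repr_self, Finsupp.single_apply]
          split_ifs <;> simp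
      | zero => simp
      | add x y hx hy h1 h2 =>
        rw [map_add]
        exact add_nonneg h1 h2
    · intro h
      rw [← b.sum_repr γ, Fintype.sum_sum_type]
      refine add_mem (sum_mem fun i _ => ?_) (sum_mem fun j _ => ?_)
      · rw [hbl]
        exact (zsmul_mem (f i).2 _ : _ ∈ unitGroup Γ).1
      · rw [hbr]
        lift b.repr γ (Sum.inr j) to ℕ using h j with n
        rw [natCast_zsmul]
        exact nsmul_mem (hg j) n
  have hcard : Fintype.card (κ ⊕ ρ) = Module.finrank ℤ M := (Module.finrank_eq_card_basis b).symm
  let e := Fintype.equivFinOfCardEq hcard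
  refine ⟨b.reindex e, Set.range (e ∘ Sum.inr), fun γ => (key γ).trans ?_⟩
  simp


/-- If the sums of the linearly independent families of `d = rank M` elements of `Γ` have a least
element with respect to `Γ`, then `Γ` is smooth. -/
lemma isSmooth_of_sum_sub_mem [Module.Free ℤ M] [Module.Finite ℤ M] {Γ : AddSubmonoid M}
    (hΓ : IsGraded Γ) (hM : AddSubgroup.closure (Γ : Set M) = ⊤) {d : ℕ}
    (hd : Module.finrank ℤ M = d) {α : Fin d → M} (hα : LinearIndependent ℤ α) (hαΓ : ∀ i, α i ∈ Γ)
    (hmin : ∀ β : Fin d → M, LinearIndependent ℤ β → (∀ i, β i ∈ Γ) → ∑ i, β i - ∑ i, α i ∈ Γ) :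
    IsSmooth Γ := by
  subst hd
  obtain ⟨Δ, D, hΔ, hD, hsum⟩ := exists_coordinates (Module.finBasis ℤ M) hα
  -- Exchange: replacing `α i` by `g` keeps independence and changes the sum by `g - α i`.
  have hex {i} {g : M} (hg : g ∈ Γ) (h : D i g ≠ 0) : g - α i ∈ Γ := by
    have := hmin (Function.update α i g) (linearIndependent_update hΔ hD h) fun j => by
      by_cases hj : j = i
      · subst hj; simpa using hg
      · simpa [Function.update_of_ne hj] using hαΓ j
    rwa [Finset.sum_update_of_mem (Finset.mem_univ i),
      ← Finset.add_sum_erase _ α (Finset.mem_univ i), ← Finset.erase_eq,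
      add_sub_add_right_eq_sub] at this
  classical
  let ρ := {i // α i ∉ unitGroup Γ}
  have : Fintype ρ := inferInstanceAs (Fintype {i // α i ∉ unitGroup Γ})
  -- Otherwise `-α i = (g - α i) - g` would lie in `Γ`, making `α i` a unit.
  have hDu {i} (hi : α i ∉ unitGroup Γ) {g : M} (hg : g ∈ unitGroup Γ) : D i g = 0 := by
    by_contra h
    refine hi ⟨hαΓ i, ?_⟩
    have := add_mem (hex hg.1 h) hg.2
    rwa [show g - α i + -g = -α i by abel] at this
  obtain ⟨n, ⟨f⟩⟩ := Submodule.nonempty_basis_of_pid (Module.finBasis ℤ M)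
    (unitGroup Γ).toIntSubmodule
  refine isSmooth_of_linearIndependent hM f (fun i : ρ => α i) (fun i => hαΓ i) ?_ ?_
  · refine hΓ.le_closure_of_descent ?_ ?_
    · rintro _ ⟨i, rfl⟩
      exact ⟨hαΓ i, i.2⟩
    · intro γ hγ hu
      -- If no nonunit `α i` can be subtracted from `γ`, then `Δ • γ` is a combination of the unit
      -- `α i` alone, so `γ` itself is a unit.
      by_contra! hcon
      refine hu (mem_unitGroup_of_zsmul hγ hΔ ?_)
      rw [hsum]
      refine sum_mem fun i _ => ?_
      by_cases hi : α i ∈ unitGroup Γ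
      · exact zsmul_mem hi _
      · have h0 : D i γ = 0 := by
          by_contra h
          exact hcon _ ⟨⟨i, hi⟩, rfl⟩ (hex hγ h)
        simp [h0]
  · refine LinearIndependent.sum_type ?_ (hα.comp _ Subtype.val_injective) ?_
    · exact f.linearIndependent.map' (unitGroup Γ).toIntSubmodule.subtype (Submodule.ker_subtype _)
    · rw [span_range_basis_unitGroup, Submodule.disjoint_def]
      intro x hx hx'
      obtain ⟨c, rfl⟩ := (Submodule.mem_span_range_iff_exists_fun ℤ).1 hx'
      -- On a unit that is a combination of the nonunit `α i`, the form `D i` is zero and also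
      -- equals `Δ` times the `i`-th coefficient.
      refine Finset.sum_eq_zero fun i _ => ?_
      have h := hDu i.2 hx
      rw [map_sum, Finset.sum_eq_single i] at h
      · simp [hD, hΔ] at h
        simp [h]
      · intro j _ hj
        simp [hD, Subtype.coe_inj, hj.symm]
      · simp

end Semigroups

end Toric

namespace Toric

/-! ### Orthants of a lattice with a basis. -/

section Smooth

variable {M : Type*} [AddCommGroup M] {ι : Type*}

/-- The subsemigroup of the elements whose coordinates with respect to `b` with index in `I` are
nonnegative. -/
def orthant (b : Module.Basis ι ℤ M) (I : Set ι) : AddSubmonoid M where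
  carrier := {γ | ∀ i ∈ I, 0 ≤ b.repr γ i}
  zero_mem' := by simp
  add_mem' ha hb i hi := by
    rw [map_add]
    exact add_nonneg (ha i hi) (hb i hi)

lemma isSmooth_iff [Module.Free ℤ M] [Module.Finite ℤ M] {Γ : AddSubmonoid M} :
    IsSmooth Γ ↔ ∃ b I, Γ = orthant (ι := Fin (Module.finrank ℤ M)) b I :=
  exists_congr fun b => exists_congr fun I => (SetLike.ext_iff (p := Γ) (q := orthant b I)).symm

lemma orthant_anti (b : Module.Basis ι ℤ M) {I J : Set ι} (h : I ⊆ J) : orthant b J ≤ orthant b I :=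
  fun _ hγ i hi => hγ i (h hi)

lemma basis_mem_orthant (b : Module.Basis ι ℤ M) (I : Set ι) (i : ι) : b i ∈ orthant b I := by
  classical
  intro j _
  rw [Module.Basis.repr_self, Finsupp.single_apply]
  split_ifs <;> simp

lemma neg_basis_mem_orthant (b : Module.Basis ι ℤ M) {I : Set ι} {i : ι} (hi : i ∉ I) :
    -b i ∈ orthant b I := by
  intro j hj
  have : i ≠ j := fun h => hi (h ▸ hj)
  simp [this]

/-- The orthant of all nonnegative coordinates is a free commutative monoid. -/
noncomputable def orthantUnivEquiv (b : Module.Basis ι ℤ M) :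
    orthant b Set.univ ≃+ (ι →₀ ℕ) where
  toFun γ := (b.repr γ).mapRange Int.toNat rfl
  invFun n := ⟨b.repr.symm (n.mapRange (fun k : ℕ => (k : ℤ)) rfl), fun i _ => by simp⟩
  left_inv γ := by
    refine Subtype.ext (b.repr.injective (Finsupp.ext fun i => ?_))
    simpa using γ.2 i trivial
  right_inv n := by ext; simp
  map_add' γ δ := by
    ext i
    simpa using Int.toNat_add (γ.2 i trivial) (δ.2 i trivial)

lemma closure_range_basis (b : Module.Basis ι ℤ M) :
    AddSubmonoid.closure (Set.range b) = orthant b Set.univ := by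
  refine le_antisymm (AddSubmonoid.closure_le.2 ?_) fun γ hγ => ?_
  · rintro _ ⟨i, rfl⟩
    exact basis_mem_orthant b _ i
  · rw [← b.linearCombination_repr γ, Finsupp.linearCombination_apply]
    refine sum_mem fun i _ => ?_
    lift b.repr γ i to ℕ using hγ i trivial with n
    simp only [natCast_zsmul]
    exact nsmul_mem (AddSubmonoid.subset_closure (Set.mem_range_self i)) n

/-- A basis vector of a free commutative monoid belongs to each system of generators. -/
lemma basis_mem_of_closure_eq (b : Module.Basis ι ℤ M) {G : Set M}
    (hG : AddSubmonoid.closure G = orthant b Set.univ) (i : ι) : b i ∈ G := by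
  have key : ∀ γ ∈ AddSubmonoid.closure G, γ = b i → b i ∈ G := by
    intro γ hγ
    induction hγ using AddSubmonoid.closure_induction with
    | mem x hx => rintro rfl; exact hx
    | zero =>
      intro h
      simpa using congrArg (fun x => b.repr x i) h
    | add x y hx hy ihx ihy =>
      intro h
      rw [hG] at hx hy
      have h1 (j) : b.repr x j + b.repr y j = b.repr (b i) j := by rw [← h, map_add]; rfl
      have h2 (j) (hj : i ≠ j) : b.repr x j = 0 ∧ b.repr y j = 0 := by
        have := h1 j
        rw [Module.Basis.repr_self, Finsupp.single_eq_of_ne hj.symm] at this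
        have := hx j trivial
        have := hy j trivial
        omega
      have h3 := h1 i
      rw [Module.Basis.repr_self, Finsupp.single_eq_same] at h3
      have hx3 := hx i trivial
      have hy3 := hy i trivial
      have h4 {z : M} (hz : ∀ j, i ≠ j → b.repr z j = 0) (hzi : b.repr z i = 1) : z = b i := by
        refine b.ext_elem fun j => ?_
        by_cases hj : i = j
        · subst hj; simp [hzi]
        · simp [hz j hj, hj]
      obtain h5 | h5 : b.repr x i = 1 ∨ b.repr y i = 1 := by omega
      · exact ihx (h4 (fun j hj => (h2 j hj).1) h5)
      · exact ihy (h4 (fun j hj => (h2 j hj).2) h5)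
  exact key _ (hG.ge (basis_mem_orthant b _ i)) rfl

/-- Every system of generators contains the basis, and the basis generates; a minimal one is
therefore the basis itself. -/
lemma encard_of_minimal_closure_eq [Fintype ι] (b : Module.Basis ι ℤ M) {G : Set M}
    (hG : Minimal (fun S => AddSubmonoid.closure S = orthant b Set.univ) G) :
    G.encard = Fintype.card ι := by
  have h : Set.range b ⊆ G := by
    rintro _ ⟨i, rfl⟩
    exact basis_mem_of_closure_eq b hG.prop i
  rw [(hG.eq_of_subset (closure_range_basis b) h).symm, ← Set.image_univ,
    b.injective.encard_image, Set.encard_univ, ENat.card_eq_coe_fintype_card]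

/-- The sum of a linearly independent family of `rank M` elements of an orthant lies in the
interior of the orthant. -/
lemma sum_sub_sum_basis_mem_orthant [Fintype ι] (b : Module.Basis ι ℤ M) {I : Set ι} {α : ι → M}
    (hα : LinearIndependent ℤ α) (hαI : ∀ i, α i ∈ orthant b I) :
    ∑ i, α i - ∑ i, b i ∈ orthant b I := by
  classical
  intro i hi
  have h0 (j) : 0 ≤ b.repr (α j) i := hαI j i hi
  have h1 : 0 < ∑ j, b.repr (α j) i := by
    refine lt_of_le_of_ne (Finset.sum_nonneg fun j _ => h0 j) fun h => ?_
    have h2 := fun j => (Finset.sum_eq_zero_iff_of_nonneg fun j _ => h0 j).1 h.symm j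
      (Finset.mem_univ j)
    -- If all `α j` had zero `i`-th coordinate, so would the nonzero multiple `Δ • b i`.
    obtain ⟨Δ, D, hΔ, -, hD⟩ := exists_coordinates b hα
    have := congrArg (fun x => b.repr x i) (hD (b i))
    simp [h2, hΔ] at this
  have h3 : b.repr (∑ j, b j) i = 1 := by
    simp [Finsupp.single_apply]
  rw [map_sub, Finsupp.sub_apply, h3, map_sum, Finsupp.finsetSum_apply]
  omega

/-- An orthant is obtained from the positive orthant by inverting one element. -/
lemma exists_add_nsmul_mem_orthant_univ [Fintype ι] (b : Module.Basis ι ℤ M) (I : Set ι) :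
    ∃ m ∈ orthant b Set.univ, -m ∈ orthant b I ∧
      ∀ γ ∈ orthant b I, ∃ n : ℕ, γ + n • m ∈ orthant b Set.univ := by
  classical
  have hm (i) : b.repr (∑ j with j ∉ I, b j) i = if i ∈ I then 0 else 1 := by
    simp [Finsupp.single_apply]
  refine ⟨∑ j with j ∉ I, b j, sum_mem fun j _ => basis_mem_orthant b _ j, ?_, fun γ hγ => ?_⟩
  · rw [← Finset.sum_neg_distrib]
    exact sum_mem fun j hj => neg_basis_mem_orthant b (Finset.mem_filter.1 hj).2
  -- This multiple exceeds the absolute value of each coordinate, so it compensates every negative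
  -- one outside `I`.
  · refine ⟨∑ i, (b.repr γ i).natAbs, fun i _ => ?_⟩
    rw [map_add, map_nsmul, Finsupp.add_apply, Finsupp.smul_apply, hm, nsmul_eq_mul]
    split_ifs with h
    · simpa using hγ i h
    · have := Finset.single_le_sum (f := fun i => (b.repr γ i).natAbs) (fun _ _ => Nat.zero_le _)
        (Finset.mem_univ i)
      rw [mul_one]
      omega

end Smooth

/-! ### Algebras of smooth semigroups. -/

section Regular

/-- Localizations of regular rings are regular. -/
lemma isRegularRing_of_isLocalization {A B : Type*} [CommRing A] [CommRing B] [Algebra A B]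
    (S : Submonoid A) [IsLocalization S B] [IsRegularRing A] : IsRegularRing B := by
  have := IsLocalization.isNoetherianRing S B inferInstance
  rw [isRegularRing_iff]
  intro q hq
  have h := IsLocalization.isLocalization_isLocalization_atPrime_isLocalization S
    (Localization.AtPrime q) q
  exact IsRegularLocalRing.of_ringEquiv (IsLocalization.algEquiv
    (q.comap (algebraMap A B)).primeCompl
    (Localization.AtPrime (q.comap (algebraMap A B))) (Localization.AtPrime q)).toRingEquiv

variable {N : Type*} [AddCommGroup N] (k : Type*) [Field k]

noncomputable def orthantUnivAlgEquiv {M : Type*} [AddCommGroup M] {ι : Type*}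
    (b : Module.Basis ι ℤ M) :
    AddMonoidAlgebra k (orthant b Set.univ) ≃ₐ[k] MvPolynomial ι k :=
  AddMonoidAlgebra.domCongr k k (orthantUnivEquiv b)

lemma exists_isLocalization_orthant {ι : Type*} [Fintype ι]
    (b : Module.Basis ι ℤ (DualLattice N)) (I : Set ι) :
    letI := (semigroupAlgebraMap k (orthant_anti b I.subset_univ)).toAlgebra
    ∃ m : orthant b Set.univ, IsLocalization.Away (AddMonoidAlgebra.single m (1 : k))
      (AddMonoidAlgebra k (orthant b I)) := by
  obtain ⟨m, hm, hm', h⟩ := exists_add_nsmul_mem_orthant_univ b I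
  exact ⟨⟨m, hm⟩, isLocalizationAway _ ⟨m, hm⟩ hm' h⟩

lemma isRegularRing_orthant {ι : Type*} [Fintype ι]
    (b : Module.Basis ι ℤ (DualLattice N)) (I : Set ι) :
    IsRegularRing (AddMonoidAlgebra k (orthant b I)) := by
  have : IsRegularRing (AddMonoidAlgebra k (orthant b Set.univ)) :=
    .of_ringEquiv (orthantUnivAlgEquiv k b).symm.toRingEquiv
  let := (semigroupAlgebraMap k (orthant_anti b I.subset_univ)).toAlgebra
  obtain ⟨m, hm⟩ := exists_isLocalization_orthant k b I
  exact isRegularRing_of_isLocalization (.powers (AddMonoidAlgebra.single m (1 : k)))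

lemma isDomain_orthant {ι : Type*} [Fintype ι] (b : Module.Basis ι ℤ (DualLattice N)) (I : Set ι) :
    IsDomain (AddMonoidAlgebra k (orthant b I)) := by
  have : IsDomain (AddMonoidAlgebra k (orthant b Set.univ)) :=
    (orthantUnivAlgEquiv k b).toMulEquiv.isDomain _
  let := (semigroupAlgebraMap k (orthant_anti b I.subset_univ)).toAlgebra
  obtain ⟨m, hm⟩ := exists_isLocalization_orthant k b I
  refine IsLocalization.isDomain_of_le_nonZeroDivisors _
    (M := .powers (AddMonoidAlgebra.single m (1 : k)))
    (powers_le_nonZeroDivisors_of_noZeroDivisors ?_)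
  intro h
  simpa using congrArg (fun f => f.coeff m) h

variable [Module.Free ℤ N] [Module.Finite ℤ N]

lemma IsSmooth.isRegularRing {Γ : AddSubmonoid (DualLattice N)} (hΓ : IsSmooth Γ) :
    IsRegularRing (AddMonoidAlgebra k Γ) := by
  obtain ⟨b, I, rfl⟩ := isSmooth_iff.1 hΓ
  exact isRegularRing_orthant k b I

lemma IsSmooth.isDomain {Γ : AddSubmonoid (DualLattice N)} (hΓ : IsSmooth Γ) :
    IsDomain (AddMonoidAlgebra k Γ) := by
  obtain ⟨b, I, rfl⟩ := isSmooth_iff.1 hΓ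
  exact isDomain_orthant k b I

/-- A basis vector with index outside `I` would be a nonzero unit. -/
lemma exists_orthant_univ_of_isSmooth {M : Type*} [AddCommGroup M] [Module.Free ℤ M]
    [Module.Finite ℤ M] {Γ : AddSubmonoid M} (hΓ : IsSmooth Γ) (hu : unitGroup Γ = ⊥) :
    ∃ b, Γ = orthant (ι := Fin (Module.finrank ℤ M)) b Set.univ := by
  obtain ⟨b, I, rfl⟩ := isSmooth_iff.1 hΓ
  refine ⟨b, ?_⟩
  suffices h : I = Set.univ by rw [h]
  refine Set.eq_univ_of_forall fun i => ?_
  by_contra hi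
  have h : b i ∈ unitGroup (orthant b I) := ⟨basis_mem_orthant b I i, neg_basis_mem_orthant b hi⟩
  rw [hu] at h
  exact b.ne_zero i h

/-- The ideal of `k[t^Γ]` generated by the monomials `t^{α_1 + ⋯ + α_d}` with `α_1, …, α_d ∈ Γ`
linearly independent. -/
noncomputable def jacobianIdeal {M : Type*} [AddCommGroup M] (Γ : AddSubmonoid M) (d : ℕ) :
    Ideal (AddMonoidAlgebra k Γ) :=
  Ideal.span {f | ∃ α : Fin d → Γ, LinearIndependent ℤ (fun i => (α i : M)) ∧
    f = AddMonoidAlgebra.single (∑ i, α i) 1}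

/-- The sum of the basis vectors is the least exponent that occurs, by
`sum_sub_sum_basis_mem_orthant`. -/
lemma IsSmooth.jacobianIdeal_eq {M : Type*} [AddCommGroup M] [Module.Free ℤ M]
    [Module.Finite ℤ M] {Γ : AddSubmonoid M} (hΓ : IsSmooth Γ) {d : ℕ}
    (hd : Module.finrank ℤ M = d) :
    ∃ μ : Γ, jacobianIdeal k Γ d = Ideal.span {AddMonoidAlgebra.single μ 1} := by
  subst hd
  obtain ⟨b, I, rfl⟩ := isSmooth_iff.1 hΓ
  let β (i) : orthant b I := ⟨b i, basis_mem_orthant b I i⟩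
  refine ⟨∑ i, β i, le_antisymm (Ideal.span_le.2 ?_) (Ideal.span_mono ?_)⟩
  · rintro _ ⟨α, hα, rfl⟩
    have h := sum_sub_sum_basis_mem_orthant b hα fun i => (α i).2
    refine Ideal.mem_span_singleton'.2 ⟨AddMonoidAlgebra.single ⟨_, h⟩ 1, ?_⟩
    rw [AddMonoidAlgebra.single_mul_single, one_mul]
    congr 1
    exact Subtype.ext (by simp [β])
  · rintro _ rfl
    exact ⟨β, b.linearIndependent, rfl⟩

end Regular

end Toric

namespace Toric

/-! ### Principal ideals and embedding dimension in local rings. -/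

section LocalRing

/-- A principal ideal of a local ring is generated by a member of each system of generators. -/
lemma exists_span_singleton_eq_of_isPrincipal {R : Type*} [CommRing R] [IsLocalRing R] {S : Set R}
    (hS : S.Nonempty) (h : (Ideal.span S).IsPrincipal) :
    ∃ s ∈ S, Ideal.span S = Ideal.span {s} := by
  obtain ⟨x, hx⟩ := h
  have hx' : Ideal.span S = Ideal.span {x} := hx
  by_contra! hne
  -- If no `s` generates, each is a nonunit multiple of `x`, whence `(x) = 𝔪 (x)`. Nakayama then
  -- gives `(x) = 0`, and any member of `S` generates the zero ideal after all.
  have hsub : ∀ s ∈ S, ∃ a ∈ IsLocalRing.maximalIdeal R, a * x = s := fun s hs => by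
    have hs' : s ∈ Ideal.span {x} := hx' ▸ Ideal.subset_span hs
    obtain ⟨a, rfl⟩ := Ideal.mem_span_singleton'.1 hs'
    refine ⟨a, fun ha => hne _ hs ?_, rfl⟩
    rw [hx']
    exact (Ideal.span_singleton_mul_left_unit (by simpa using ha) x).symm
  have hle : Ideal.span {x} ≤ IsLocalRing.maximalIdeal R * Ideal.span {x} := by
    rw [← hx', Ideal.span_le, hx']
    intro s hs
    obtain ⟨a, ha, rfl⟩ := hsub s hs
    exact Ideal.mul_mem_mul ha (Ideal.mem_span_singleton_self x)
  have h0 : Ideal.span {x} = ⊥ := Submodule.eq_bot_of_le_smul_of_le_jacobson_bot _ _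
    ⟨{x}, by simp⟩ hle (IsLocalRing.maximalIdeal_le_jacobson _)
  obtain ⟨s, hs⟩ := hS
  refine hne s hs ?_
  have hs' : s ∈ Ideal.span {x} := hx' ▸ Ideal.subset_span hs
  rw [h0, Ideal.mem_bot] at hs'
  rw [hx', h0, hs']
  simp

/-- Derivations at a point of `Spec A` which are dual to functions vanishing at this point bound
the embedding dimension from below. -/
lemma natCard_le_spanFinrank_maximalIdeal {A K : Type*} [CommRing A] [Field K] (χ : A →+* K)
    (p : Ideal A) [p.IsPrime] (hp : ∀ x, x ∈ p ↔ χ x = 0)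
    [IsNoetherianRing (Localization.AtPrime p)] {J : Type*} [DecidableEq J] (D : J → A →+ K)
    (hD : ∀ j a b, D j (a * b) = χ a * D j b + χ b * D j a) (y : J → A) (hy : ∀ j, χ (y j) = 0)
    (hDy : ∀ i j, D i (y j) = (Pi.single j 1 : J → K) i) :
    Finite J ∧ Nat.card J ≤
      (IsLocalRing.maximalIdeal (Localization.AtPrime p)).spanFinrank := by
  set R := Localization.AtPrime p
  have hfg : (IsLocalRing.maximalIdeal R).FG := IsNoetherian.noetherian _
  let X := (IsLocalRing.maximalIdeal R).generators
  have hXfin : X.Finite := Submodule.FG.finite_generators hfg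
  have hX : Ideal.span X = IsLocalRing.maximalIdeal R := Submodule.span_generators _
  -- Denominators are units of `R`, so generators of the maximal ideal may be taken in `A`, where
  -- the derivations are defined.
  have hnum (x : R) : ∃ a : A, Ideal.span {algebraMap A R a} = Ideal.span {x} := by
    obtain ⟨a, s, rfl⟩ := IsLocalization.exists_mk'_eq p.primeCompl x
    refine ⟨a, ?_⟩
    rw [← IsLocalization.mk'_spec R a s]
    exact Ideal.span_singleton_mul_right_unit (IsLocalization.map_units R s) _
  choose a ha using hnum
  have hXT : (Ideal.span (a '' X)).map (algebraMap A R) = IsLocalRing.maximalIdeal R := by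
    rw [Ideal.map_span, ← hX, Set.image_image]
    refine le_antisymm (Ideal.span_le.2 ?_) (Ideal.span_le.2 fun x hx => ?_)
    · rintro _ ⟨x, hx, rfl⟩
      have := Ideal.mem_span_singleton_self (algebraMap A R (a x))
      rw [ha] at this
      exact Ideal.span_mono (Set.singleton_subset_iff.2 hx) this
    · have := Ideal.mem_span_singleton_self x
      rw [← ha] at this
      exact Ideal.span_mono (Set.singleton_subset_iff.2 (Set.mem_image_of_mem _ hx)) this
  let W : Submodule K (J → K) := Submodule.span K ((fun t j => D j t) '' (a '' X))
  -- For `x ∈ p` the Leibniz rule reduces to `D j (c * x) = χ c * D j x`, so the span of the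
  -- derivative vectors of the generators absorbs the whole ideal.
  have hW : ∀ z ∈ Ideal.span (a '' X), z ∈ p ∧ (fun j => D j z) ∈ W := by
    intro z hz
    induction hz using Submodule.span_induction with
    | mem x hx =>
      refine ⟨?_, Submodule.subset_span ⟨x, hx, rfl⟩⟩
      rw [← IsLocalization.AtPrime.to_map_mem_maximal_iff R p, ← hXT]
      exact Ideal.mem_map_of_mem _ (Ideal.subset_span hx)
    | zero => exact ⟨zero_mem _, by simp only [map_zero]; exact zero_mem W⟩
    | add x y _ _ hx hy =>
      refine ⟨add_mem hx.1 hy.1, ?_⟩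
      convert add_mem hx.2 hy.2 using 1
      ext; simp
    | smul c x _ hx =>
      refine ⟨Ideal.mul_mem_left _ c hx.1, ?_⟩
      convert W.smul_mem (χ c) hx.2 using 1
      ext j
      simp [hD, (hp x).1 hx.1]
  -- Only a multiple `s * y j` with `χ s ≠ 0` is known to lie in the ideal; its derivative vector is
  -- `χ s` times that of `y j`.
  have hyW (j) : Pi.single j 1 ∈ W := by
    have hmem : algebraMap A R (y j) ∈ (Ideal.span (a '' X)).map (algebraMap A R) := by
      rw [hXT, IsLocalization.AtPrime.to_map_mem_maximal_iff R p]
      exact (hp _).2 (hy j)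
    obtain ⟨s, hs, hs'⟩ := (IsLocalization.algebraMap_mem_map_algebraMap_iff
      p.primeCompl R _ _).1 hmem
    convert W.smul_mem (χ s)⁻¹ (hW _ hs').2 using 1
    have hs0 : χ s ≠ 0 := fun h => hs ((hp s).2 h)
    ext i
    simp [hD, hy, hDy, hs0]
  have hli : LinearIndependent K fun j : J => (Pi.single j 1 : J → K) :=
    Pi.linearIndependent_single_one J K
  have hYfin : ((fun t j => D j t) '' (a '' X)).Finite := (hXfin.image a).image _
  have hsub : Set.range (fun j : J => (Pi.single j 1 : J → K)) ⊆ W := by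
    rintro _ ⟨j, rfl⟩
    exact hyW j
  have := hYfin.fintype
  have := hli.finite_of_le_span_finite _ _ hsub
  refine ⟨this, ?_⟩
  have h1 := linearIndependent_le_span' _ hli _ hsub
  rw [← Nat.cast_card, Nat.cast_le, ← Nat.card_eq_fintype_card, Nat.card_coe_set_eq] at h1
  calc Nat.card J ≤ _ := h1
    _ ≤ (a '' X).ncard := Set.ncard_image_le (hXfin.image a)
    _ ≤ X.ncard := Set.ncard_image_le hXfin
    _ = _ := Submodule.FG.generators_ncard hfg

end LocalRing

/-! ### The distinguished point of a chart. -/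

section Character

variable {M : Type*} [AddCommGroup M] (k : Type*) [Field k] (Γ : AddSubmonoid M)

open Classical in
/-- The character of `Γ` which is `1` on the units and `0` elsewhere. -/
noncomputable def unitCharacter : Multiplicative Γ →* k where
  toFun γ := if (γ.toAdd : M) ∈ unitGroup Γ then 1 else 0
  map_one' := if_pos (zero_mem (unitGroup Γ))
  map_mul' a b := by
    have := add_mem_unitGroup_iff a.toAdd.2 b.toAdd.2
    simp only [toAdd_mul, AddSubmonoid.coe_add, this]
    split_ifs <;> simp_all

/-- The point of `Spec k[t^Γ]` at which the units of `Γ` take the value `1` and the other elements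
of `Γ` vanish. -/
noncomputable def augmentation : AddMonoidAlgebra k Γ →ₐ[k] k :=
  AddMonoidAlgebra.lift k k Γ (unitCharacter k Γ)

variable {k Γ}

lemma augmentation_single_of_mem {γ : Γ} (h : (γ : M) ∈ unitGroup Γ) :
    augmentation k Γ (AddMonoidAlgebra.single γ 1) = 1 := by
  simp [augmentation, unitCharacter, h]

lemma augmentation_single_of_notMem {γ : Γ} (h : (γ : M) ∉ unitGroup Γ) :
    augmentation k Γ (AddMonoidAlgebra.single γ 1) = 0 := by
  simp [augmentation, unitCharacter, h]

lemma exists_unit_of_augmentation_ne_zero {f : AddMonoidAlgebra k Γ}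
    (h : augmentation k Γ f ≠ 0) : ∃ u : Γ, (u : M) ∈ unitGroup Γ ∧ f.coeff u ≠ 0 := by
  rw [augmentation, AddMonoidAlgebra.lift_apply] at h
  obtain ⟨u, hu, hu'⟩ := Finset.exists_ne_zero_of_sum_ne_zero h
  refine ⟨u, ?_, Finsupp.mem_support_iff.1 hu⟩
  by_contra hn
  simp [unitCharacter, hn] at hu'

/-- The maximal ideal of the point `augmentation k Γ`. -/
noncomputable abbrev augmentationIdeal (k : Type*) [Field k] (Γ : AddSubmonoid M) :
    Ideal (AddMonoidAlgebra k Γ) :=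
  RingHom.ker (augmentation k Γ)

instance : (augmentationIdeal k Γ).IsPrime := RingHom.ker_isPrime _

/-- Each basis vector is a difference `x i - y i` of elements of `Γ`. Expanding the determinant
multilinearly, some mixed choice of `x i` and `-y i` has nonzero determinant, and signs do not
affect independence. -/
lemma exists_linearIndependent_of_closure_eq_top [Module.Free ℤ M] [Module.Finite ℤ M]
    (hM : AddSubgroup.closure (Γ : Set M) = ⊤) {d : ℕ} (hd : Module.finrank ℤ M = d) :
    ∃ α : Fin d → Γ, LinearIndependent ℤ fun i => (α i : M) := by
  subst hd
  let b := Module.finBasis ℤ M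
  have hdiff (m : M) : ∃ x y : Γ, m = x + -y := by
    have : m ∈ AddSubgroup.closure (Γ : Set M) := hM ▸ AddSubgroup.mem_top m
    induction this using AddSubgroup.closure_induction with
    | mem x hx => exact ⟨⟨x, hx⟩, 0, by simp⟩
    | zero => exact ⟨0, 0, by simp⟩
    | add a b _ _ ha hb =>
      obtain ⟨x, y, rfl⟩ := ha
      obtain ⟨x', y', rfl⟩ := hb
      exact ⟨x + x', y + y', by push_cast; abel⟩
    | neg a _ ha =>
      obtain ⟨x, y, rfl⟩ := ha
      exact ⟨y, x, by abel⟩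
  choose x y hxy using fun i => hdiff (b i)
  have hdet : b.det ((fun i => (x i : M)) + fun i => -(y i : M)) ≠ 0 := by
    rw [show ((fun i => (x i : M)) + fun i => -(y i : M)) = b from funext fun i => (hxy i).symm,
      b.det_self]
    exact one_ne_zero
  have hadd := b.det.toMultilinearMap.map_add_univ (fun i => (x i : M)) fun i => -(y i : M)
  rw [AlternatingMap.coe_multilinearMap] at hadd
  rw [hadd] at hdet
  obtain ⟨s, -, hs⟩ := Finset.exists_ne_zero_of_sum_ne_zero hdet
  have hli : LinearIndependent ℤ (s.piecewise (fun i => (x i : M)) fun i => -(y i : M)) := by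
    by_contra h
    exact hs (b.det.map_linearDependent _ h)
  refine ⟨s.piecewise x y, ?_⟩
  convert hli.units_smul (s.piecewise (fun _ => (1 : ℤˣ)) fun _ => -1) using 1
  ext i
  by_cases hi : i ∈ s <;> simp [hi]

lemma exists_sum_sub_mem_of_isPrincipal [Module.Free ℤ M] [Module.Finite ℤ M]
    (hM : AddSubgroup.closure (Γ : Set M) = ⊤) {d : ℕ} (hd : Module.finrank ℤ M = d)
    (h : ((jacobianIdeal k Γ d).map (algebraMap _
      (Localization.AtPrime (augmentationIdeal k Γ)))).IsPrincipal) :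
    ∃ α : Fin d → M, LinearIndependent ℤ α ∧ (∀ i, α i ∈ Γ) ∧
      ∀ β : Fin d → M, LinearIndependent ℤ β → (∀ i, β i ∈ Γ) → ∑ i, β i - ∑ i, α i ∈ Γ := by
  obtain ⟨α₀, hα₀⟩ := exists_linearIndependent_of_closure_eq_top hM hd
  rw [jacobianIdeal, Ideal.map_span] at h
  obtain ⟨_, ⟨_, ⟨α, hα, rfl⟩, rfl⟩, he⟩ :=
    exists_span_singleton_eq_of_isPrincipal 
      (by exact .image _ ⟨_, α₀, hα₀, rfl⟩) h
  refine ⟨fun i => α i, hα, fun i => (α i).2, fun β hβ hβΓ => ?_⟩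
  lift β to Fin d → Γ using hβΓ
  have hmem : algebraMap _ (Localization.AtPrime (augmentationIdeal k Γ))
      (AddMonoidAlgebra.single (∑ i, β i) (1 : k)) ∈
        (Ideal.span {AddMonoidAlgebra.single (∑ i, α i) (1 : k)}).map (algebraMap _
          (Localization.AtPrime (augmentationIdeal k Γ))) := by
    rw [Ideal.map_span, Set.image_singleton, ← he]
    exact Ideal.subset_span (Set.mem_image_of_mem _ ⟨β, hβ, rfl⟩)
  obtain ⟨s, hs, hs'⟩ := (IsLocalization.algebraMap_mem_map_algebraMap_iff
    (augmentationIdeal k Γ).primeCompl _ _ _).1 hmem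
  obtain ⟨a, ha⟩ := Ideal.mem_span_singleton'.1 hs'
  obtain ⟨u, hu, hsu⟩ := exists_unit_of_augmentation_ne_zero (f := s) hs
  -- The denominator `s` has a nonzero coefficient at some unit `u`. Hence `u + ∑ β_i` occurs in a
  -- multiple of `t^(∑ α_i)`, and `u` can be subtracted within `Γ`.
  have hc : (a * AddMonoidAlgebra.single (∑ i, α i) 1).coeff (u + ∑ i, β i) ≠ 0 := by
    rw [ha, AddMonoidAlgebra.coeff_mul_single_eq_coeff_mul u (by simp), mul_one]
    exact hsu
  have hd : ∃ γ : Γ, γ + ∑ i, α i = u + ∑ i, β i := by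
    by_contra! hne
    exact hc (AddMonoidAlgebra.coeff_mul_single_of_forall_add_ne _ _ hne)
  obtain ⟨γ, hγ⟩ := hd
  have hγ' : (γ : M) + ∑ i, (α i : M) = u + ∑ i, (β i : M) := by
    simpa using congrArg (Subtype.val) hγ
  rw [show ∑ i, (β i : M) - ∑ i, (α i : M) = γ + -u by
    rw [sub_eq_iff_eq_add, add_right_comm, hγ']; abel]
  exact add_mem γ.2 hu.2

end Character

end Toric

namespace Toric

/-! ### The dimension of `k[t^Γ]` is at most the rank of `M`. -/

section Dimension

lemma ringKrullDim_le_of_isIntegral {A B : Type*} [CommRing A] [CommRing B] (g : A →+* B)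
    (hg : g.IsIntegral) : ringKrullDim B ≤ ringKrullDim A := by
  let := g.toAlgebra
  have : Algebra.IsIntegral A B := ⟨hg⟩
  refine Order.krullDim_le_of_strictMono (PrimeSpectrum.comap g) fun p q hpq => ?_
  exact Ideal.IsIntegral.comap_lt_comap (R := A) hpq

open Cardinal in
-- By Noether normalization `A` is integral over a polynomial ring in `n` variables. This bounds its
-- dimension by `n`, and the variables stay algebraically independent in `L`, so `n ≤ d`.
lemma ringKrullDim_le_of_trdeg_le {k A L : Type*} [Field k] [CommRing A] [Nontrivial A]
    [Algebra k A] [Algebra.FiniteType k A] [CommRing L] [Algebra k L] (φ : A →ₐ[k] L)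
    (hφ : Function.Injective φ) {d : ℕ} (hd : Algebra.trdeg k L ≤ d) : ringKrullDim A ≤ d := by
  obtain ⟨n, g, hg, hg'⟩ := exists_integral_inj_algHom_of_fg k A
  refine (ringKrullDim_le_of_isIntegral _ hg').trans ?_
  rw [MvPolynomial.ringKrullDim_of_isNoetherianRing, ringKrullDim_eq_zero_of_field, zero_add,
    Nat.card_fin]
  have h := lift_trdeg_le_of_injective (φ.comp g) (hφ.comp hg)
  rw [MvPolynomial.trdeg_of_isDomain] at h
  have h' := h.trans (Cardinal.lift_le.2 hd)
  simp at h'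
  exact_mod_cast h'

variable {N : Type*} [AddCommGroup N] (k : Type*) [Field k]

/-- `orthant b ∅` is all of `M`; the Laurent polynomial ring is a localization of, hence algebraic
over, the polynomial ring. -/
lemma trdeg_orthant_empty_le {ι : Type*} [Fintype ι] (b : Module.Basis ι ℤ (DualLattice N)) :
    Algebra.trdeg k (AddMonoidAlgebra k (orthant b ∅)) ≤ Fintype.card ι := by
  have := isDomain_orthant k b ∅
  let := (semigroupAlgebraMap k (orthant_anti b (Set.empty_subset Set.univ))).toAlgebra
  obtain ⟨m, hm⟩ := exists_isLocalization_orthant k b ∅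
  have : IsScalarTower k (AddMonoidAlgebra k (orthant b Set.univ))
      (AddMonoidAlgebra k (orthant b ∅)) := by
    refine .of_algebraMap_eq fun x => ?_
    rw [RingHom.algebraMap_toAlgebra]
    exact (semigroupAlgebraMap_single _ 0 x).symm
  have : FaithfulSMul (AddMonoidAlgebra k (orthant b Set.univ))
      (AddMonoidAlgebra k (orthant b ∅)) :=
    (faithfulSMul_iff_algebraMap_injective _ _).2 (semigroupAlgebraMap_injective _)
  have : Algebra.IsAlgebraic (AddMonoidAlgebra k (orthant b Set.univ))
      (AddMonoidAlgebra k (orthant b ∅)) :=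
    IsLocalization.isAlgebraic _ (.powers (AddMonoidAlgebra.single m (1 : k)))
  rw [← trdeg_add_eq k (AddMonoidAlgebra k (orthant b Set.univ)),
    trdeg_eq_zero (R := AddMonoidAlgebra k (orthant b Set.univ)), add_zero]
  have h := (orthantUnivAlgEquiv k b).lift_trdeg_eq
  rw [MvPolynomial.trdeg_of_isDomain] at h
  have h' := h.le
  simp at h'
  exact_mod_cast h'

variable [Module.Free ℤ N] [Module.Finite ℤ N]

lemma ringKrullDim_semigroupAlgebra_le {Γ : AddSubmonoid (DualLattice N)} (hfg : Γ.FG) {d : ℕ}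
    (hd : Module.finrank ℤ (DualLattice N) = d) :
    ringKrullDim (AddMonoidAlgebra k Γ) ≤ d := by
  subst hd
  let b := Module.finBasis ℤ (DualLattice N)
  have hle : Γ ≤ orthant b ∅ := fun _ _ _ h => h.elim
  have : AddMonoid.FG Γ := (AddMonoid.fg_iff_addSubmonoid_fg Γ).2 hfg
  refine ringKrullDim_le_of_trdeg_le (k := k)
    (AddMonoidAlgebra.mapDomainAlgHom k k (AddSubmonoid.inclusion hle))
    (semigroupAlgebraMap_injective hle) ((trdeg_orthant_empty_le k b).trans (by simp))

end Dimension

/-! ### Tangent vectors at the distinguished point. -/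

section Derivations

variable {M : Type*} [AddCommGroup M] {k : Type*} [Field k] {Γ : AddSubmonoid M}

/-- The additive map `k[t^Γ] → k` with `a t^γ ↦ a θ(γ)`. -/
noncomputable def coeffSum (θ : Γ → k) : AddMonoidAlgebra k Γ →+ k :=
  (Finsupp.liftAddHom fun γ => AddMonoidHom.mulRight (θ γ)).comp
    AddMonoidAlgebra.coeffAddEquiv.toAddMonoidHom

@[simp]
lemma coeffSum_single (θ : Γ → k) (γ : Γ) (a : k) :
    coeffSum θ (AddMonoidAlgebra.single γ a) = a * θ γ := by
  simp [coeffSum]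

lemma augmentation_single (γ : Γ) (a : k) :
    augmentation k Γ (AddMonoidAlgebra.single γ a) = a * unitCharacter k Γ (.ofAdd γ) := by
  simp [augmentation]

lemma unitCharacter_of_mem {γ : Γ} (h : (γ : M) ∈ unitGroup Γ) :
    unitCharacter k Γ (.ofAdd γ) = 1 := if_pos h

lemma unitCharacter_of_notMem {γ : Γ} (h : (γ : M) ∉ unitGroup Γ) :
    unitCharacter k Γ (.ofAdd γ) = 0 := if_neg h

/-- By bilinearity, a derivation at the distinguished point need only satisfy the Leibniz rule on
monomials. -/
lemma coeffSum_mul {θ : Γ → k} (hθ : ∀ a b, θ (a + b) =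
      unitCharacter k Γ (.ofAdd a) * θ b + unitCharacter k Γ (.ofAdd b) * θ a)
    (f g : AddMonoidAlgebra k Γ) :
    coeffSum θ (f * g) = augmentation k Γ f * coeffSum θ g + augmentation k Γ g * coeffSum θ f := by
  induction f using AddMonoidAlgebra.induction_linear with
  | zero => simp
  | add f f' hf hf' => rw [add_mul, map_add, hf, hf', map_add, map_add]; ring
  | single a x =>
    induction g using AddMonoidAlgebra.induction_linear with
    | zero => simp
    | add g g' hg hg' => rw [mul_add, map_add, hg, hg', map_add, map_add]; ring
    | single b y =>
      rw [AddMonoidAlgebra.single_mul_single, coeffSum_single, coeffSum_single, coeffSum_single,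
        augmentation_single, augmentation_single, hθ]
      ring

open Classical in
/-- The function on `Γ` which is an additive character `φ` on the units and `0` elsewhere. -/
noncomputable def unitPart (φ : unitGroup Γ →+ k) (γ : Γ) : k :=
  if h : (γ : M) ∈ unitGroup Γ then φ ⟨γ, h⟩ else 0

lemma unitPart_add (φ : unitGroup Γ →+ k) (a b : Γ) :
    unitPart φ (a + b) = unitCharacter k Γ (.ofAdd a) * unitPart φ b +
      unitCharacter k Γ (.ofAdd b) * unitPart φ a := by
  have h := add_mem_unitGroup_iff a.2 b.2
  by_cases ha : (a : M) ∈ unitGroup Γ <;> by_cases hb : (b : M) ∈ unitGroup Γ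
  · rw [unitCharacter_of_mem ha, unitCharacter_of_mem hb]
    simp only [unitPart, AddSubmonoid.coe_add, h, ha, hb, and_self, dite_true, one_mul]
    rw [add_comm (φ _), ← map_add]
    rfl
  all_goals simp [unitPart, h, ha, hb, unitCharacter_of_mem, unitCharacter_of_notMem]

open Classical in
/-- The characteristic function of the class of `g` modulo the units of `Γ`. -/
noncomputable def classIndicator (k : Type*) [Field k] (g : M) (γ : Γ) : k :=
  if (γ : M) - g ∈ unitGroup Γ then 1 else 0

lemma classIndicator_of_mem {g : M} (hg : g ∉ unitGroup Γ) {γ : Γ} (hγ : (γ : M) ∈ unitGroup Γ) :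
    classIndicator k g γ = 0 :=
  if_neg fun h => hg (by simpa using sub_mem hγ h)

lemma classIndicator_add_of_mem {g : M} {a : Γ} (b : Γ) (ha : (a : M) ∈ unitGroup Γ) :
    classIndicator k g (a + b) = classIndicator k g b := by
  unfold classIndicator
  rw [AddSubmonoid.coe_add, add_sub_assoc, AddSubgroup.add_mem_cancel_left _ ha]

lemma classIndicator_add {g : M} (hg : g ∈ irreducibles Γ) (a b : Γ) :
    classIndicator k g (a + b) = unitCharacter k Γ (.ofAdd a) * classIndicator k g b +
      unitCharacter k Γ (.ofAdd b) * classIndicator k g a := by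
  by_cases ha : (a : M) ∈ unitGroup Γ
  · rw [classIndicator_add_of_mem b ha, classIndicator_of_mem hg.2.1 ha, unitCharacter_of_mem ha]
    simp
  by_cases hb : (b : M) ∈ unitGroup Γ
  · rw [add_comm a b, classIndicator_add_of_mem a hb, classIndicator_of_mem hg.2.1 hb,
      unitCharacter_of_mem hb]
    simp
  rw [unitCharacter_of_notMem ha, unitCharacter_of_notMem hb, zero_mul, zero_mul, add_zero]
  refine if_neg fun h => ?_
  -- If two nonunits had sum `g + w` with `w` a unit, then `g = (a - w) + b` would contradict
  -- irreducibility.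
  have h1 := hg.2.2 (a - (a + b - g)) (by rw [sub_eq_add_neg]; exact add_mem a.2 h.2) b b.2
    (by abel)
  rcases h1 with h1 | h1
  · exact ha (by simpa using add_mem h1 h)
  · exact hb h1

end Derivations

/-! ### Regularity at the distinguished point forces smoothness. -/

section Regular

variable {N : Type*} [AddCommGroup N] [Module.Free ℤ N] [Module.Finite ℤ N] (k : Type*) [Field k]

lemma isSmooth_of_isRegularLocalRing {Γ : AddSubmonoid (DualLattice N)} (hfg : Γ.FG)
    (hΓ : IsGraded Γ) (hM : AddSubgroup.closure (Γ : Set (DualLattice N)) = ⊤)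
    (h : IsRegularLocalRing (Localization.AtPrime (augmentationIdeal k Γ))) : IsSmooth Γ := by
  classical
  obtain ⟨n, ⟨f⟩⟩ := Submodule.nonempty_basis_of_pid (Module.finBasis ℤ (DualLattice N))
    (unitGroup Γ).toIntSubmodule
  -- Irreducibles differing by a unit give the same cotangent direction, so one representative per
  -- class is kept.
  let ρ := {q : DualLattice N ⧸ unitGroup Γ // ∃ g ∈ irreducibles Γ, (g : DualLattice N ⧸ _) = q}
  choose g hg hgq using fun q : ρ => q.2
  let D : Fin n ⊕ ρ → AddMonoidAlgebra k Γ →+ k := Sum.elim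
    (fun i => coeffSum (unitPart ((Int.castAddHom k).comp (f.coord i).toAddMonoidHom)))
    (fun q => coeffSum (classIndicator k (g q)))
  -- Unit monomials take the value `1` at the point, so `1` is subtracted; the dual pairing with `D`
  -- is the identity matrix, which survives in every characteristic.
  let y : Fin n ⊕ ρ → AddMonoidAlgebra k Γ := Sum.elim
    (fun i => AddMonoidAlgebra.single ⟨f i, (f i).2.1⟩ 1 - 1)
    (fun q => AddMonoidAlgebra.single ⟨g q, (hg q).1⟩ 1)
  have hu (i) : (f i : DualLattice N) ∈ unitGroup Γ := (f i).2
  obtain ⟨hfin, hcard⟩ := natCard_le_spanFinrank_maximalIdeal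
    (augmentation k Γ : AddMonoidAlgebra k Γ →+* k) (augmentationIdeal k Γ) (fun _ => Iff.rfl) D
    (by
      rintro (i | q) a b
      · exact coeffSum_mul (unitPart_add _) a b
      · exact coeffSum_mul (classIndicator_add (hg q)) a b)
    y
    (by
      rintro (i | q)
      · simp [y, augmentation_single_of_mem, hu]
      · simp [y, augmentation_single_of_notMem, (hg q).2.1])
    (by
      rintro (i | q) (j | r)
      · simp [D, y, AddMonoidAlgebra.one_def, unitPart, hu]
        have h0 : (f.coord i) (0 : (unitGroup Γ).toIntSubmodule) = 0 := map_zero _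
        have h1 : (f.coord i) (f j) = (Pi.single j 1 : Fin n → ℤ) i := by
          simp [Finsupp.single_apply, Pi.single_apply, eq_comm]
        change (((f.coord i) (f j) : ℤ) : k) - (((f.coord i) 0 : ℤ) : k) = _
        rw [h0, h1]
        by_cases hij : i = j
        · simp [hij]
        · simp [hij]
      · simp [D, y, unitPart, (hg r).2.1]
      · simp [D, y, AddMonoidAlgebra.one_def, classIndicator_of_mem (hg q).2.1, hu]
      · simp [D, y, classIndicator]
        rw [sub_eq_neg_add, ← QuotientAddGroup.eq, hgq, hgq, Subtype.coe_inj]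
        by_cases hqr : q = r
        · simp [hqr]
        · simp [hqr])
  -- Regularity enters only here: the embedding dimension equals the height of the ideal, which is
  -- at most `dim k[t^Γ] ≤ d`.
  have hle : Nat.card (Fin n ⊕ ρ) ≤ Module.finrank ℤ (DualLattice N) := by
    have h1 := h.spanFinrank_maximalIdeal
    rw [IsLocalization.AtPrime.ringKrullDim_eq_height (augmentationIdeal k Γ)] at h1
    have h2 := (Ideal.height_le_ringKrullDim_of_ne_top
      (inferInstance : (augmentationIdeal k Γ).IsPrime).ne_top).trans
        (ringKrullDim_semigroupAlgebra_le k hfg rfl)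
    rw [← h1] at h2
    exact hcard.trans (by exact_mod_cast h2)
  have := Finite.sum_right (Fin n) (β := ρ)
  have hgen : Γ ≤ AddSubmonoid.closure (unitGroup Γ ∪ Set.range g) := by
    refine hΓ.le_closure_irreducibles.trans (AddSubmonoid.closure_le.2 ?_)
    rintro x (hx | hx)
    · exact AddSubmonoid.subset_closure (Or.inl hx)
    · let q : ρ := ⟨x, x, hx, rfl⟩
      rw [← add_neg_cancel_left (g q) x]
      exact add_mem (AddSubmonoid.subset_closure (Or.inr ⟨q, rfl⟩))
        (AddSubmonoid.subset_closure (Or.inl (QuotientAddGroup.eq.1 (hgq q))))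
  refine isSmooth_of_linearIndependent hM f g (fun q => (hg q).1) hgen ?_
  cases nonempty_fintype ρ
  have hspan := span_eq_top_of_le_closure hM hgen
  rw [← span_sumElim_eq f g] at hspan
  -- A spanning family of at most rank-many vectors is a basis.
  refine linearIndependent_of_top_le_span_of_card_eq_finrank hspan.ge (le_antisymm ?_ ?_)
  · rwa [← Nat.card_eq_fintype_card]
  · exact finrank_le_of_span_eq_top hspan

end Regular

end Toric

namespace Toric

universe u

section Isomorphisms

lemma comap_isoInv {R S : CommRingCat.{u}} (e : R ≅ S) (J : Ideal R) :
    J.comap e.inv.hom = J.map e.hom.hom := by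
  refine le_antisymm (fun x hx => ?_) ?_
  · have h := Ideal.mem_map_of_mem e.hom.hom (Ideal.mem_comap.1 hx)
    rwa [← CommRingCat.comp_apply, Iso.inv_hom_id, CommRingCat.id_apply] at h
  · rw [Ideal.map_le_iff_le_comap, Ideal.comap_comap, ← CommRingCat.hom_comp, Iso.hom_inv_id,
      CommRingCat.hom_id, Ideal.comap_id]

lemma isoHom_mem_nonZeroDivisors {R S : CommRingCat.{u}} (e : R ≅ S) {x : R}
    (hx : x ∈ nonZeroDivisors R) : e.hom.hom x ∈ nonZeroDivisors S :=
  (MulEquivClass.map_nonZeroDivisors e.commRingCatIsoToRingEquiv).le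
    (Submonoid.mem_map_of_mem _ hx)

end Isomorphisms

/-! ### Ideal sheaves on affine schemes, restriction and direct image. -/

section IdealSheaves

/-- The ideal sheaf on `Spec A` given by an ideal of `A`. -/
noncomputable def specIdealSheaf {A : CommRingCat.{u}} (J : Ideal A) : (Spec A).IdealSheafData :=
  Scheme.IdealSheafData.ofIdealTop (J.map (Scheme.ΓSpecIso A).inv.hom)

/-- The ideal of `A` given by an ideal sheaf on `Spec A`. -/
noncomputable def specIdeal {A : CommRingCat.{u}} (I : (Spec A).IdealSheafData) : Ideal A :=
  (I.ideal ⟨⊤, isAffineOpen_top _⟩).comap (Scheme.ΓSpecIso A).inv.hom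

lemma ofIdealTop_le_iff {X : Scheme.{u}} [IsAffine X] {J : Ideal Γ(X, ⊤)} {I : X.IdealSheafData} :
    Scheme.IdealSheafData.ofIdealTop J ≤ I ↔ J ≤ I.ideal ⟨⊤, isAffineOpen_top X⟩ := by
  have h : (Scheme.IdealSheafData.ofIdealTop J).ideal ⟨⊤, isAffineOpen_top X⟩ = J := by simp
  refine ⟨fun hle => ?_, fun hle => Scheme.IdealSheafData.le_of_isAffine (h.trans_le hle)⟩
  rw [← h]
  exact hle _

lemma specIdealSheaf_le_iff {A : CommRingCat.{u}} {J : Ideal A} {I : (Spec A).IdealSheafData} :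
    specIdealSheaf J ≤ I ↔ J ≤ specIdeal I := by
  rw [specIdealSheaf, ofIdealTop_le_iff, Ideal.map_le_iff_le_comap, specIdeal]

lemma specIdeal_specIdealSheaf {A : CommRingCat.{u}} (J : Ideal A) :
    specIdeal (specIdealSheaf J) = J := by
  have h : (specIdealSheaf J).ideal ⟨⊤, isAffineOpen_top _⟩ =
      J.map (Scheme.ΓSpecIso A).symm.hom.hom := by
    simp [specIdealSheaf]
  rw [specIdeal, h, ← comap_isoInv, Ideal.comap_comap, Iso.symm_inv, ← CommRingCat.hom_comp,
    Iso.inv_hom_id, CommRingCat.hom_id, Ideal.comap_id]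

lemma specIdealSheaf_specIdeal {A : CommRingCat.{u}} (I : (Spec A).IdealSheafData) :
    specIdealSheaf (specIdeal I) = I := by
  refine le_antisymm (specIdealSheaf_le_iff.2 le_rfl) (Scheme.IdealSheafData.le_of_isAffine ?_)
  have h : (specIdealSheaf (specIdeal I)).ideal ⟨⊤, isAffineOpen_top _⟩ =
      (specIdeal I).map (Scheme.ΓSpecIso A).symm.hom.hom := by
    simp [specIdealSheaf]
  rw [h, ← comap_isoInv, specIdeal, Ideal.comap_comap, Iso.symm_inv, ← CommRingCat.hom_comp,
    Iso.hom_inv_id, CommRingCat.hom_id, Ideal.comap_id]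

lemma specIdeal_map {A B : CommRingCat.{u}} (φ : A ⟶ B) (I : (Spec B).IdealSheafData) :
    specIdeal (I.map (Spec.map φ)) = (specIdeal I).comap φ.hom := by
  rw [specIdeal, specIdeal, Scheme.IdealSheafData.ideal_map_of_isAffineHom, Ideal.comap_comap,
    Ideal.comap_comap, ← CommRingCat.hom_comp, ← CommRingCat.hom_comp,
    Scheme.ΓSpecIso_inv_naturality]
  rfl

/-- Obtained from the direct image formula `specIdeal_map` by uniqueness of adjoints. -/
lemma specIdealSheaf_comap {A B : CommRingCat.{u}} (φ : A ⟶ B) (J : Ideal A) :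
    (specIdealSheaf J).comap (Spec.map φ) = specIdealSheaf (J.map φ.hom) := by
  refine eq_of_forall_ge_iff fun I => ?_
  rw [← Scheme.IdealSheafData.le_map_iff_comap_le, specIdealSheaf_le_iff, specIdeal_map,
    ← Ideal.map_le_iff_le_comap, specIdealSheaf_le_iff]

/-- `I.map f` is the kernel of the composite of the closed subscheme of `I` with `f`; pasting
pullback squares reduces the claim to compatibility of kernels with open immersions. -/
lemma comap_map_of_isPullback {U V X Y : Scheme.{u}} {g : U ⟶ V} {iU : U ⟶ X} {iV : V ⟶ Y}
    {f : X ⟶ Y} [IsOpenImmersion iU] [IsOpenImmersion iV] [QuasiCompact f]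
    (H : IsPullback g iU iV f) (I : X.IdealSheafData) :
    (I.map f).comap iV = (I.comap iU).map g := by
  have h1 : IsPullback (I.comap iU).subschemeι (Scheme.IdealSheafData.subschemeMap _ _ iU
      (I.le_map_comap iU)) iU I.subschemeι :=
    isPullback_of_isClosedImmersion _ _ _ _ (by simp) (by simp)
  have h2 := h1.flip.paste_vert H.flip
  refine Scheme.IdealSheafData.ext (funext fun W => ?_)
  rw [Scheme.IdealSheafData.ideal_comap_of_isOpenImmersion]
  exact (Scheme.ker_ideal_of_isPullback_of_isOpenImmersion _ _ _ _ h2.flip W).symm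

lemma comap_iInf_of_isOpenImmersion {X Y : Scheme.{u}} {ι : Type*} [Finite ι]
    (I : ι → Y.IdealSheafData) (f : X ⟶ Y) [IsOpenImmersion f] :
    (⨅ i, I i).comap f = ⨅ i, (I i).comap f := by
  refine Scheme.IdealSheafData.ext (funext fun W => ?_)
  rw [Scheme.IdealSheafData.ideal_comap_of_isOpenImmersion, Scheme.IdealSheafData.ideal_iInf,
    Scheme.IdealSheafData.ideal_iInf, iInf_apply, iInf_apply, Ideal.comap_iInf]
  simp only [Scheme.IdealSheafData.ideal_comap_of_isOpenImmersion]

end IdealSheaves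

/-! ### Invertible ideal sheaves. -/

section Invertible

lemma comap_isoInv_span {R S : CommRingCat.{u}} (e : R ≅ S) (x : R) :
    (Ideal.span {x}).comap e.inv.hom = Ideal.span {e.hom.hom x} := by
  rw [comap_isoInv, Ideal.map_span, Set.image_singleton]

/-- Invertibility of an ideal sheaf is local. -/
lemma isInvertible_of_comap {X : Scheme.{u}} {ι : Type*} {U : ι → Scheme.{u}} (f : ∀ i, U i ⟶ X)
    [∀ i, IsOpenImmersion (f i)] (hf : ∀ x, ∃ i y, f i y = x) {I : X.IdealSheafData}
    (h : ∀ i, IsInvertible (I.comap (f i))) : IsInvertible I := by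
  intro x
  obtain ⟨i, y, rfl⟩ := hf x
  obtain ⟨W, hy, s, hs, hW⟩ := h i y
  let V : X.affineOpens := ⟨f i ''ᵁ W, W.2.image_of_isOpenImmersion _⟩
  refine ⟨V, ⟨y, hy, rfl⟩, ((f i).appIso W).inv.hom s, ?_, ?_⟩
  · exact isoHom_mem_nonZeroDivisors ((f i).appIso W).symm hs
  · rw [Scheme.IdealSheafData.ideal_comap_of_isOpenImmersion] at hW
    have h := congrArg (Ideal.comap ((f i).appIso W).hom.hom) hW
    rw [Ideal.comap_comap, ← CommRingCat.hom_comp, Iso.hom_inv_id, CommRingCat.hom_id,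
      Ideal.comap_id] at h
    exact h.trans (comap_isoInv_span ((f i).appIso W).symm s)

lemma isInvertible_specIdealSheaf {A : CommRingCat.{u}} {a : A} (ha : a ∈ nonZeroDivisors A) :
    IsInvertible (specIdealSheaf (Ideal.span {a})) := by
  intro x
  refine ⟨⟨⊤, isAffineOpen_top _⟩, trivial, (Scheme.ΓSpecIso A).inv.hom a, ?_, ?_⟩
  · exact isoHom_mem_nonZeroDivisors (Scheme.ΓSpecIso A).symm ha
  · simp [specIdealSheaf, Ideal.map_span]

lemma isPrincipal_specIdeal_comap_of_isOpenImmersion {X : Scheme.{u}} (I : X.IdealSheafData)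
    {R : CommRingCat.{u}} (f : Spec R ⟶ X) [IsOpenImmersion f]
    (h : (I.ideal ⟨f ''ᵁ ⊤, (isAffineOpen_top _).image_of_isOpenImmersion f⟩).IsPrincipal) :
    (specIdeal (I.comap f)).IsPrincipal := by
  obtain ⟨t, ht⟩ := h
  refine ⟨(Scheme.ΓSpecIso R).hom.hom ((f.appIso ⊤).hom.hom t), ?_⟩
  rw [specIdeal, Scheme.IdealSheafData.ideal_comap_of_isOpenImmersion, ht]
  exact (congrArg _ (comap_isoInv_span (f.appIso ⊤) t)).trans
    (comap_isoInv_span (Scheme.ΓSpecIso R) _)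

/-- Every point of a local scheme specializes to the closed point, so `j` factors through any affine
open containing the image of that point, in particular one where `I` is principal. -/
lemma IsInvertible.isPrincipal_specIdeal_comap {X : Scheme.{u}} {I : X.IdealSheafData}
    (hI : IsInvertible I) {A : CommRingCat.{u}} [IsLocalRing A] (j : Spec A ⟶ X) :
    (specIdeal (I.comap j)).IsPrincipal := by
  obtain ⟨U, hU, s, -, hs⟩ := hI (j (IsLocalRing.closedPoint A))
  have : IsOpenImmersion U.2.fromSpec := U.2.isOpenImmersion_fromSpec
  have hr : Set.range j ⊆ Set.range U.2.fromSpec := by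
    rw [U.2.range_fromSpec]
    rintro _ ⟨x, rfl⟩
    exact ((IsLocalRing.specializes_closedPoint x).map j.continuous).mem_open U.1.2 hU
  obtain ⟨φ, hφ⟩ := Spec.map_surjective (IsOpenImmersion.lift U.2.fromSpec j hr)
  have hj : j = Spec.map φ ≫ U.2.fromSpec := by rw [hφ, IsOpenImmersion.lift_fac]
  have hV : (specIdeal (I.comap U.2.fromSpec)).IsPrincipal := by
    have h : ∀ V : X.affineOpens, V = U → (I.ideal V).IsPrincipal := by
      rintro _ rfl
      exact ⟨s, hs⟩
    exact isPrincipal_specIdeal_comap_of_isOpenImmersion _ _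
      (h _ (Subtype.ext ((Scheme.Hom.image_top_eq_opensRange _).trans U.2.opensRange_fromSpec)))
  obtain ⟨t, ht⟩ := hV
  rw [hj, Scheme.IdealSheafData.comap_comp, ← specIdealSheaf_specIdeal (I.comap U.2.fromSpec),
    specIdealSheaf_comap, specIdeal_specIdealSheaf]
  refine ⟨φ.hom t, ?_⟩
  rw [ht]
  exact Ideal.map_span _ _ |>.trans (by simp)

end Invertible

/-! ### Blowing-ups that are isomorphisms. -/

section BlowUp

/-- When `J` is invertible the identity of `X` factors through `π`; this section is a two-sided
inverse, since `π` factors through itself in only one way. -/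
lemma IsBlowUp.isIso_iff {X B : Scheme.{u}} {J : X.IdealSheafData} {π : B ⟶ X}
    (h : IsBlowUp J π) : IsIso π ↔ IsInvertible J := by
  constructor
  · intro hπ
    exact isInvertible_of_comap (fun _ : Unit => π)
      (fun x => ⟨(), inv π x, by rw [← Scheme.Hom.comp_apply]; simp⟩) fun _ => h.invertible
  · intro hJ
    obtain ⟨s, hs, -⟩ := h.existsUnique_fac X (𝟙 X)
      (by rwa [Scheme.IdealSheafData.comap_id])
    refine ⟨s, ?_, hs⟩
    exact (h.existsUnique_fac B π h.invertible).unique (by simp [hs]) (by simp)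

lemma isBlowUp_id {X : Scheme.{u}} {J : X.IdealSheafData} (hJ : IsInvertible J) :
    IsBlowUp J (𝟙 X) where
  invertible := by rwa [Scheme.IdealSheafData.comap_id]
  existsUnique_fac T g _ := ⟨g, by simp, fun h hh => by simpa using hh⟩

end BlowUp

end Toric

/-! ### Gluing the logarithmic jacobian ideals. -/

namespace Toric

universe u v

variable {N : Type v} [AddCommGroup N]

/-- The formation of the logarithmic jacobian ideal commutes with inverting a monomial. -/
lemma jacobianIdeal_map [Module.Free ℤ N] [Module.Finite ℤ N] (k : Type u) [Field k]
    {Γ Γ' : AddSubmonoid (DualLattice N)} (h : Γ ≤ Γ')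
    {m : DualLattice N} (hmΓ : m ∈ Γ) (hm : -m ∈ Γ') (hΓ : ∀ γ ∈ Γ', ∃ n : ℕ, γ + n • m ∈ Γ)
    {d : ℕ} (hd : Module.finrank ℤ (DualLattice N) = d) :
    (jacobianIdeal k Γ d).map (semigroupAlgebraMap k h) = jacobianIdeal k Γ' d := by
  classical
  refine le_antisymm ?_ (Ideal.span_le.2 ?_)
  · rw [jacobianIdeal, Ideal.map_span, Ideal.span_le]
    rintro _ ⟨_, ⟨α, hα, rfl⟩, rfl⟩
    refine Ideal.subset_span ⟨fun i => AddSubmonoid.inclusion h (α i), hα, ?_⟩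
    rw [semigroupAlgebraMap_single, map_sum]
  · rintro _ ⟨α, hα, rfl⟩
    obtain ⟨n₀, hn₀⟩ : ∃ n₀ : ℕ, ∀ n, n₀ ≤ n → ∀ i, (α i : DualLattice N) + n • m ∈ Γ := by
      choose n hn using fun i => hΓ (α i) (α i).2
      refine ⟨∑ i, n i, fun l hl i => ?_⟩
      have hi : n i ≤ l := (Finset.single_le_sum (fun _ _ => Nat.zero_le _)
        (Finset.mem_univ i)).trans hl
      rw [← Nat.add_sub_cancel' hi, add_nsmul, ← add_assoc]
      exact add_mem (hn i) (nsmul_mem hmΓ _)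
    let b : Module.Basis (Fin d) ℤ (DualLattice N) := Module.finBasisOfFinrankEq ℤ _ hd
    obtain ⟨δ, E, hδ, hE, hrepr⟩ := exists_coordinates b hα
    -- Up to a nonzero factor this is the determinant of the translates `α i + n • m`. It is affine
    -- in `n` with value `δ ≠ 0` at `0`, so it cannot vanish at both `n₀` and `n₀ + 1`.
    obtain ⟨n, hn, hne⟩ : ∃ n, n₀ ≤ n ∧ δ + n * ∑ i, E i m ≠ 0 := by
      by_cases h0 : δ + n₀ * ∑ i, E i m = 0
      · refine ⟨n₀ + 1, by omega, fun h1 => ?_⟩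
        push_cast at h1
        have h2 : ∑ i, E i m = 0 := by linarith
        rw [h2] at h0
        exact hδ (by simpa using h0)
      · exact ⟨n₀, le_rfl, h0⟩
    have hli : LinearIndependent ℤ fun i => (α i : DualLattice N) + n • m := by
      rw [Fintype.linearIndependent_iff]
      intro c hc
      have h1 (j) : δ * c j + n * (∑ i, c i) * E j m = 0 := by
        have := congrArg (E j) hc
        simp only [map_sum, map_add, map_zsmul, map_nsmul, smul_add, hE, map_zero,
          Finset.sum_add_distrib, smul_eq_mul, nsmul_eq_mul, mul_ite, mul_zero,
          Finset.sum_ite_eq, Finset.mem_univ, if_true, ← Finset.sum_mul] at this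
        linarith
      have h2 : (δ + n * ∑ i, E i m) * ∑ i, c i = 0 := by
        have := Finset.sum_congr rfl fun j (_ : j ∈ Finset.univ) => h1 j
        rw [Finset.sum_add_distrib, ← Finset.mul_sum, ← Finset.mul_sum] at this
        rw [Finset.sum_const_zero] at this
        linarith
      have h3 := (mul_eq_zero.1 h2).resolve_left hne
      intro j
      have := h1 j
      rw [h3] at this
      simpa [hδ] using this
    let β (i : Fin d) : Γ := ⟨α i + n • m, hn₀ n hn i⟩
    have hmem : AddMonoidAlgebra.single (∑ i, β i) (1 : k) ∈ jacobianIdeal k Γ d :=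
      Ideal.subset_span ⟨β, hli, rfl⟩
    have hsum : ∑ i, α i = (d * n) • (⟨-m, hm⟩ : Γ') + AddSubmonoid.inclusion h (∑ i, β i) := by
      refine Subtype.ext ?_
      simp [β, Finset.sum_add_distrib, mul_nsmul']
    have e : AddMonoidAlgebra.single (∑ i, α i) (1 : k) =
        AddMonoidAlgebra.single ((d * n) • (⟨-m, hm⟩ : Γ')) 1 *
          semigroupAlgebraMap k h (.single (∑ i, β i) 1) := by
      rw [semigroupAlgebraMap_single, AddMonoidAlgebra.single_mul_single, one_mul, hsum]
    rw [SetLike.mem_coe, e]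
    exact Ideal.mul_mem_left _ _ (Ideal.mem_map_of_mem _ hmem)

namespace ToricDatum

variable [Module.Free ℤ N] [Module.Finite ℤ N] (k : Type u) [Field k] (D : ToricDatum N)

instance (σ : D.fan.Cone) : IsNoetherianRing (AddMonoidAlgebra k (D.Γ σ)) := by
  have : AddMonoid.FG (D.Γ σ) := (AddMonoid.fg_iff_addSubmonoid_fg _).2 (D.fg σ)
  exact Algebra.FiniteType.isNoetherianRing k _

instance (σ : D.fan.Cone) : QuasiCompact (D.chartMap k σ) := by
  have : IsNoetherian (D.chart k σ) := inferInstance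
  infer_instance

lemma finrank_dualLattice : Module.finrank ℤ (DualLattice N) = Module.finrank ℤ N :=
  (Module.finrank_linearMap ℤ ℤ N ℤ).trans (by simp)

lemma logJacobianIdeal_map {σ τ : D.fan.Cone} (h : τ ≤ σ) :
    (D.logJacobianIdeal k σ).map (semigroupAlgebraMap k (Γ_anti h)) = D.logJacobianIdeal k τ := by
  obtain ⟨m, hτ⟩ := D.exists_cutOut σ τ h
  obtain ⟨-, h1, h2⟩ := D.exists_add_nsmul_mem σ τ m.2 hτ
  exact jacobianIdeal_map k (Γ_anti h) m.2 h1 h2 finrank_dualLattice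

/-- The open immersion of charts `T^{Γ_τ} → T^{Γ_σ}` for `τ ≤ σ`. -/
noncomputable def chartInclusion {σ τ : D.fan.Cone} (h : τ ≤ σ) : D.chart k τ ⟶ D.chart k σ :=
  (D.diagram k).map (homOfLE h)

instance {σ τ : D.fan.Cone} (h : τ ≤ σ) : IsOpenImmersion (D.chartInclusion k h) :=
  inferInstanceAs (IsOpenImmersion ((D.diagram k).map (homOfLE h)))

lemma chartLogJacobian_comap {σ τ : D.fan.Cone} (h : τ ≤ σ) :
    (D.chartLogJacobian k σ).comap (D.chartInclusion k h) = D.chartLogJacobian k τ := by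
  have e := specIdealSheaf_comap (CommRingCat.ofHom (semigroupAlgebraMap k (Γ_anti h)))
    (D.logJacobianIdeal k σ)
  rw [CommRingCat.hom_ofHom, logJacobianIdeal_map k D h] at e
  exact e

lemma exists_chartMap_eq (x : D.toricVariety k) : ∃ σ y, D.chartMap k σ y = x :=
  Scheme.IsLocallyDirected.ι_jointly_surjective (D.diagram k) x

/-- The intersection of two charts. -/
lemma isPullback_chartMap {σ τ ρ : D.fan.Cone} (hσ : ρ ≤ σ) (hτ : ρ ≤ τ)
    (h : σ.1 ⊓ τ.1 ≤ ρ.1) :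
    IsPullback (D.chartInclusion k hσ) (D.chartInclusion k hτ) (D.chartMap k σ)
      (D.chartMap k τ) := by
  have w : D.chartInclusion k hτ ≫ D.chartMap k τ = D.chartInclusion k hσ ≫ D.chartMap k σ :=
    (colimit.w (D.diagram k) (homOfLE hτ)).trans (colimit.w (D.diagram k) (homOfLE hσ)).symm
  refine IsOpenImmersion.isPullback _ _ _ _ w ?_
  ext x
  constructor
  · rintro ⟨y, hy⟩
    obtain ⟨κ, hκσ, hκτ, z, -, hz⟩ :=
      (Scheme.IsLocallyDirected.ι_eq_ι_iff (D.diagram k)).1 hy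
    have hκ : κ ≤ ρ := (le_inf (leOfHom hκσ) (leOfHom hκτ)).trans h
    have e : D.chartInclusion k hκ ≫ D.chartInclusion k hτ = (D.diagram k).map hκτ :=
      ((D.diagram k).map_comp _ _).symm
    refine ⟨D.chartInclusion k hκ z, ?_⟩
    rw [← hz, ← e]
    rfl
  · rintro ⟨y, rfl⟩
    refine ⟨D.chartInclusion k hσ y, ?_⟩
    rw [← Scheme.Hom.comp_apply, ← w, Scheme.Hom.comp_apply]

/-- The infimum loses nothing on the chart of `τ`: the direct image from the chart of `σ` restricts
there to a direct image from the chart of `σ ∩ τ`, where both jacobian ideals agree. -/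
lemma logJacobian_comap (τ : D.fan.Cone) :
    (D.logJacobian k).comap (D.chartMap k τ) = D.chartLogJacobian k τ := by
  refine le_antisymm (Scheme.IdealSheafData.le_map_iff_comap_le.1 (iInf_le _ τ)) ?_
  rw [logJacobian, comap_iInf_of_isOpenImmersion]
  refine le_iInf fun σ => ?_
  let ρ : D.fan.Cone := ⟨σ.1 ⊓ τ.1, D.fan.face_mem σ.1 σ.2 _
    (D.fan.inter_isFace σ.1 σ.2 τ.1 τ.2).1⟩
  have hσ : ρ ≤ σ := (inf_le_left : σ.1 ⊓ τ.1 ≤ σ.1)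
  have hτ : ρ ≤ τ := (inf_le_right : σ.1 ⊓ τ.1 ≤ τ.1)
  rw [comap_map_of_isPullback (D.isPullback_chartMap k hσ hτ le_rfl).flip,
    Scheme.IdealSheafData.le_map_iff_comap_le, chartLogJacobian_comap, chartLogJacobian_comap]

end ToricDatum

end Toric

/-! ### The equivalences for toric varieties. -/

namespace Toric

universe u v

namespace ToricDatum

variable {N : Type v} [AddCommGroup N]

/-- A unit is both nonnegative and nonpositive on `σ`, which spans. -/
lemma unitGroup_eq_bot (D : ToricDatum N) {σ : D.fan.Cone}
    (hσ : Submodule.span ℝ (σ.1 : Set (RealSpace N)) = ⊤) : unitGroup (D.Γ σ) = ⊥ := by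
  refine (AddSubgroup.eq_bot_iff_forall _).2 fun γ hγ => ?_
  have h : toReal γ = 0 := by
    refine LinearMap.ext_on hσ fun x hx => le_antisymm ?_ (D.nonneg σ hγ.1 hx)
    have := D.nonneg σ hγ.2 hx
    rw [map_neg, LinearMap.neg_apply] at this
    rw [LinearMap.zero_apply]
    linarith
  ext n
  have := congrArg (fun f => f ((1 : ℝ) ⊗ₜ[ℤ] n)) h
  simpa using this

variable [Module.Free ℤ N] [Module.Finite ℤ N]

/-- The degree is the sum of the values at lattice generators of `σ`. In degree `0` the form
vanishes on `σ`, so a positive multiple of `-γ` lies in `Γ_σ`; adding copies of `γ` gives `-γ`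
itself, although `Γ_σ` need not be saturated. -/
lemma isGraded (D : ToricDatum N) (σ : D.fan.Cone) : IsGraded (D.Γ σ) := by
  obtain ⟨S, hS⟩ := D.fan.rational σ.1 σ.2
  have h0 (γ : DualLattice N) (hγ : γ ∈ D.Γ σ) (s : N) (hs : s ∈ S) : 0 ≤ γ s := by
    have h := D.nonneg σ hγ (x := (1 : ℝ) ⊗ₜ[ℤ] s)
      (by rw [hS]; exact PointedCone.subset_hull ⟨s, hs, rfl⟩)
    rw [toReal_tmul, mul_one] at h
    exact_mod_cast h
  refine ⟨∑ s ∈ S, (LinearMap.applyₗ (R := ℤ) (M₂ := ℤ) s).toAddMonoidHom, fun γ hγ => ?_⟩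
  have hl : (∑ s ∈ S, (LinearMap.applyₗ (R := ℤ) (M₂ := ℤ) s).toAddMonoidHom) γ =
      ∑ s ∈ S, γ s := by simp
  rw [hl]
  refine ⟨Finset.sum_nonneg (h0 γ hγ), fun h => ?_⟩
  have hz := (Finset.sum_eq_zero_iff_of_nonneg (h0 γ hγ)).1 h
  have hd : toReal (-γ) ∈ dualCone σ.1 := by
    rw [mem_dualCone]
    intro x hx
    rw [hS] at hx
    suffices toReal (-γ) x = 0 from this.ge
    induction hx using Submodule.span_induction with
    | mem _ h =>
      obtain ⟨s, hs, rfl⟩ := h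
      simp [hz s hs]
    | zero => rw [map_zero]
    | add a b _ _ ha hb => rw [map_add, ha, hb, add_zero]
    | smul c a _ ha => rw [show c • a = (c : ℝ) • a from rfl, map_smul, ha, smul_zero]
  rw [← D.hull_eq σ] at hd
  obtain ⟨n, hn, h⟩ := exists_nsmul_mem_of_mem_hull _ _ hd
  obtain ⟨p, rfl⟩ := Nat.exists_eq_add_of_le' hn
  rw [show -γ = (p + 1) • -γ + p • γ by rw [succ_nsmul, smul_neg]; abel]
  exact add_mem h (nsmul_mem hγ p)

variable (k : Type u) [Field k] (D : ToricDatum N)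

lemma isSmooth_of_isPrincipal_map (σ : D.fan.Cone)
    (h : ((D.logJacobianIdeal k σ).map (algebraMap _
      (Localization.AtPrime (augmentationIdeal k (D.Γ σ))))).IsPrincipal) :
    IsSmooth (D.Γ σ) := by
  obtain ⟨α, hα, hαΓ, hmin⟩ :=
    exists_sum_sub_mem_of_isPrincipal (D.closure_eq_top σ) finrank_dualLattice h
  exact isSmooth_of_sum_sub_mem (D.isGraded σ) (D.closure_eq_top σ) finrank_dualLattice hα hαΓ hmin

lemma isInvertible_logJacobian_iff :
    IsInvertible (D.logJacobian k) ↔ ∀ σ, IsSmooth (D.Γ σ) := by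
  constructor
  · intro h σ
    refine D.isSmooth_of_isPrincipal_map k σ ?_
    let φ : CommRingCat.of (AddMonoidAlgebra k (D.Γ σ)) ⟶
        CommRingCat.of (Localization.AtPrime (augmentationIdeal k (D.Γ σ))) :=
      CommRingCat.ofHom (algebraMap _ _)
    have : IsLocalRing (CommRingCat.of (Localization.AtPrime (augmentationIdeal k (D.Γ σ)))) :=
      inferInstanceAs (IsLocalRing (Localization.AtPrime (augmentationIdeal k (D.Γ σ))))
    have e := h.isPrincipal_specIdeal_comap (Spec.map φ ≫ D.chartMap k σ)
    have e' : ((D.logJacobian k).comap (Spec.map φ ≫ D.chartMap k σ)) =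
        specIdealSheaf ((D.logJacobianIdeal k σ).map φ.hom) := by
      rw [Scheme.IdealSheafData.comap_comp, logJacobian_comap]
      exact specIdealSheaf_comap φ _
    rwa [e', specIdeal_specIdealSheaf] at e
  · intro h
    refine isInvertible_of_comap (D.chartMap k) (D.exists_chartMap_eq k) fun σ => ?_
    rw [logJacobian_comap]
    obtain ⟨μ, hμ⟩ := (h σ).jacobianIdeal_eq k finrank_dualLattice
    have := (h σ).isDomain k
    have hne : (AddMonoidAlgebra.single μ 1 : AddMonoidAlgebra k (D.Γ σ)) ≠ 0 := fun h0 => by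
      simpa using congrArg (fun f => f.coeff μ) h0
    have hinv := isInvertible_specIdealSheaf
      (A := CommRingCat.of (AddMonoidAlgebra k (D.Γ σ))) (mem_nonZeroDivisors_of_ne_zero hne)
    have e : D.chartLogJacobian k σ = specIdealSheaf (A := CommRingCat.of _)
        (Ideal.span {(AddMonoidAlgebra.single μ 1 : AddMonoidAlgebra k (D.Γ σ))}) :=
      congrArg (specIdealSheaf (A := CommRingCat.of _)) hμ
    rw [e]
    exact hinv

lemma isNonsingular_iff : IsNonsingular (D.toricVariety k) ↔ ∀ σ, IsSmooth (D.Γ σ) := by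
  have e (σ : D.fan.Cone) (p : D.chart k σ)
      (q : PrimeSpectrum (AddMonoidAlgebra k (D.Γ σ))) (hpq : p = q) :
      Nonempty ((D.toricVariety k).presheaf.stalk (D.chartMap k σ p) ≃+*
        Localization.AtPrime q.asIdeal) := by
    subst hpq
    exact ⟨(asIso ((D.chartMap k σ).stalkMap p)).commRingCatIsoToRingEquiv.trans
      (Spec.stalkIso (CommRingCat.of (AddMonoidAlgebra k (D.Γ σ))) p).commRingCatIsoToRingEquiv⟩
  constructor
  · intro h σ
    obtain ⟨e⟩ := e σ _ ⟨augmentationIdeal k (D.Γ σ), inferInstance⟩ rfl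
    have := h (D.chartMap k σ ⟨augmentationIdeal k (D.Γ σ), inferInstance⟩)
    exact isSmooth_of_isRegularLocalRing k (D.fg σ) (D.isGraded σ) (D.closure_eq_top σ)
      (.of_ringEquiv e)
  · intro h x
    obtain ⟨σ, p, rfl⟩ := D.exists_chartMap_eq k x
    let q : PrimeSpectrum (AddMonoidAlgebra k (D.Γ σ)) := p
    obtain ⟨e⟩ := e σ p q rfl
    have := (h σ).isRegularRing k
    have := IsRegularRing.isRegularLocalRing_localization (R := AddMonoidAlgebra k (D.Γ σ))
      q.asIdeal
    exact .of_ringEquiv e.symm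

lemma isNonsingular_iff_isInvertible :
    IsNonsingular (D.toricVariety k) ↔ IsInvertible (D.logJacobian k) :=
  (D.isNonsingular_iff k).trans (D.isInvertible_logJacobian_iff k).symm

lemma exists_eq_orthant_of_isPrincipal {σ : D.fan.Cone}
    (hσ : Submodule.span ℝ (σ.1 : Set (RealSpace N)) = ⊤)
    (h : (D.logJacobianIdeal k σ).IsPrincipal) :
    ∃ b : Module.Basis (Fin (Module.finrank ℤ N)) ℤ (DualLattice N),
      D.Γ σ = orthant b Set.univ := by
  have hs : IsSmooth (D.Γ σ) := by
    refine D.isSmooth_of_isPrincipal_map k σ ?_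
    obtain ⟨t, ht⟩ := h
    refine ⟨algebraMap _ _ t, ?_⟩
    rw [ht]
    exact (Ideal.map_span _ _).trans (by rw [Set.image_singleton])
  have := exists_orthant_univ_of_isSmooth hs (D.unitGroup_eq_bot hσ)
  rwa [finrank_dualLattice] at this

end ToricDatum

end Toric

/-- Part (a) appears both for some and for every blowing-up, since a blowing-up is given by its
universal property alone and neither form presupposes that one exists. Full dimension of `σ` is
expressed by its real span. -/
theorem mainTheorem3 {N : Type*} [AddCommGroup N] [Module.Free ℤ N] [Module.Finite ℤ N]
    (k : Type*) [Field k] (D : Toric.ToricDatum N) :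
    (Toric.IsNonsingular (D.toricVariety k) ↔
      ∃ (B : Scheme) (π : B ⟶ D.toricVariety k),
        Toric.IsBlowUp (D.logJacobian k) π ∧ IsIso π) ∧
    (∀ (B : Scheme) (π : B ⟶ D.toricVariety k), Toric.IsBlowUp (D.logJacobian k) π →
      (Toric.IsNonsingular (D.toricVariety k) ↔ IsIso π)) ∧
    (∀ σ : D.fan.Cone, Submodule.span ℝ (σ.1 : Set (Toric.RealSpace N)) = ⊤ →
      (D.logJacobianIdeal k σ).IsPrincipal →
        (∀ G : Set (Toric.DualLattice N),
          Minimal (fun S => AddSubmonoid.closure S = D.Γ σ) G →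
            G.encard = Module.finrank ℤ N) ∧
        Nonempty (AddMonoidAlgebra k (D.Γ σ) ≃ₐ[k]
          MvPolynomial (Fin (Module.finrank ℤ N)) k)) := by
  refine ⟨?_, fun B π hπ => (D.isNonsingular_iff_isInvertible k).trans hπ.isIso_iff.symm,
    fun σ hσ h => ?_⟩
  · rw [D.isNonsingular_iff_isInvertible k]
    exact ⟨fun h => ⟨_, 𝟙 _, Toric.isBlowUp_id h, inferInstance⟩,
      fun ⟨_, _, hπ, hi⟩ => hπ.isIso_iff.1 hi⟩
  · obtain ⟨b, hb⟩ := D.exists_eq_orthant_of_isPrincipal k hσ h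
    rw [hb]
    exact ⟨fun G hG => by simpa using Toric.encard_of_minimal_closure_eq b hG,
      ⟨Toric.orthantUnivAlgEquiv k b⟩⟩
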